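/- Let $(M^3,g)$ be a smooth Riemannian manifold of dimension $3$, with Levi-Civita connection $\nabla$, Riemann tensor $R(X,Y)Z=\nabla_X\nabla_YZ-\nabla_Y\nabla_XZ-\nabla_{[X,Y]}Z$, Ricci form $\mathrm{ric}(X,Y)=\operatorname{tr}(Z\mapsto R(Z,X)Y)$ and Ricci operator $\mathrm{Ric}=g^{-1}\mathrm{ric}$. Assume that for every $p\in M$ and every $v\in T_pM$ with $g(v,v)=1$ there are $\varepsilon>0$, a geodesic $\gamma:(-\varepsilon,\varepsilon)\to M$ with $\gamma(0)=p$, $\gamma'(0)=v$, and a differentiable field of endomorphisms $u(t)\in\mathrm{End}(T_{\gamma(t)}M)$ along $\gamma$ solving the Riccati equation $$u'(t)+u(t)^2+R(\,\cdot\,,\gamma'(t))\gamma'(t)=0,\qquad u'=\nabla_{\gamma'}u,$$ and such that, for all $t\in(-\varepsilon,\varepsilon)$, $u(t)$ is symmetric with respect to $g$, $\operatorname{tr}u(t)=0$ and $u(t)\gamma'(t)=0$. Then there is no non-empty open set $U\subseteq M$ such that $\mathrm{Ric}$ has rank exactly $1$ at every point of $U$. -/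

import Mathlib

open scoped Manifold ContDiff

noncomputable section

namespace RiccatiGeometry

/-- The model space `ℝⁿ`. -/
abbrev Model (n : ℕ) : Type := EuclideanSpace ℝ (Fin n)

/-- A smooth Riemannian metric on a smooth `n`-manifold without boundary. -/
abbrev Metric (n : ℕ) (M : Type*) [TopologicalSpace M] [ChartedSpace (Model n) M]
    [IsManifold (𝓡 n) ∞ M] : Type _ :=
  Bundle.ContMDiffRiemannianMetric (𝓡 n) ∞ (Model n) (fun x : M => TangentSpace (𝓡 n) x)

variable {n : ℕ} {M : Type*} [TopologicalSpace M] [ChartedSpace (Model n) M]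

/-- The smooth charts of `M`: the members of its maximal smooth atlas. -/
def IsSmoothChart (φ : OpenPartialHomeomorph M (Model n)) : Prop :=
  φ ∈ IsManifold.maximalAtlas (𝓡 n) ∞ M

/-- The partial derivative `∂ᵢ f` at `y ∈ ℝⁿ`. -/
def partialDeriv (i : Fin n) (f : Model n → ℝ) (y : Model n) : ℝ :=
  fderiv ℝ f y (EuclideanSpace.single i 1)

/-- The coordinate vector `∂ᵢ = (dφ)⁻¹ eᵢ ∈ T_x M` of the chart `φ` at a point `x` of its domain. -/
def coordVector (φ : OpenPartialHomeomorph M (Model n)) (x : M) (i : Fin n) :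
    TangentSpace (𝓡 n) x :=
  (mfderiv (𝓡 n) (𝓡 n) φ x).inverse (EuclideanSpace.single i (1 : ℝ) : Model n)

/-- The `i`-th component in the chart `φ` of a tangent vector `w ∈ T_x M`. -/
def component (φ : OpenPartialHomeomorph M (Model n)) (x : M) (w : TangentSpace (𝓡 n) x)
    (i : Fin n) : ℝ :=
  (show Model n from mfderiv (𝓡 n) (𝓡 n) φ x w) i

section Curvature

variable [IsManifold (𝓡 n) ∞ M] (g : Metric n M) (φ : OpenPartialHomeomorph M (Model n))

/-- The metric coefficients `g_{ij} = g(∂ᵢ, ∂ⱼ)`, as functions of the coordinate `y ∈ φ.target`. -/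
def metricCoeff (y : Model n) : Matrix (Fin n) (Fin n) ℝ :=
  Matrix.of fun i j =>
    g.inner (φ.symm y) (coordVector φ (φ.symm y) i) (coordVector φ (φ.symm y) j)

/-- The Christoffel symbols `Γᵏ_{ij}` of the Levi-Civita connection, `∇_{∂ᵢ} ∂ⱼ = Γᵏ_{ij} ∂ₖ`. -/
def christoffel (k i j : Fin n) (y : Model n) : ℝ :=
  (1 / 2 : ℝ) * ∑ l, (metricCoeff g φ y)⁻¹ k l *
    (partialDeriv i (fun z => metricCoeff g φ z j l) y
      + partialDeriv j (fun z => metricCoeff g φ z i l) y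
      - partialDeriv l (fun z => metricCoeff g φ z i j) y)

/-- The components of the Riemann tensor `R(X,Y)Z = ∇_X ∇_Y Z - ∇_Y ∇_X Z - ∇_{[X,Y]} Z`:
`R(∂ᵢ, ∂ⱼ) ∂ₖ = ∑ₗ (riemann l i j k) ∂ₗ`. -/
def riemann (l i j k : Fin n) (y : Model n) : ℝ :=
  partialDeriv i (christoffel g φ l j k) y - partialDeriv j (christoffel g φ l i k) y
    + ∑ m, (christoffel g φ m j k y * christoffel g φ l i m y
        - christoffel g φ m i k y * christoffel g φ l j m y)

/-- The components of the Ricci form, `ric(X,Y) = tr (Z ↦ R(Z,X)Y)`. -/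
def ricciForm (y : Model n) : Matrix (Fin n) (Fin n) ℝ :=
  Matrix.of fun j k => ∑ i, riemann g φ i i j k y

/-- The matrix of the Ricci operator `Ric = g⁻¹ ric` in the basis `∂₁, …, ∂ₙ`. -/
def ricciOperator (y : Model n) : Matrix (Fin n) (Fin n) ℝ :=
  (metricCoeff g φ y)⁻¹ * ricciForm g φ y

/-- The matrix of the Jacobi operator `J(v) = R(·, v)v` in the basis `∂₁, …, ∂ₙ`, for a vector
`v = ∑ⱼ vʲ ∂ⱼ`. -/
def jacobiOperator (y : Model n) (v : Fin n → ℝ) : Matrix (Fin n) (Fin n) ℝ :=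
  Matrix.of fun l i => ∑ j, ∑ k, riemann g φ l i j k y * v j * v k

end Curvature

/-- The Ricci operator of `g` at `x` has rank `r`: its matrix has rank `r` in the smooth charts
around `x` (by tensoriality the rank does not depend on the chart, and there is always one). -/
def RicciHasRank [IsManifold (𝓡 n) ∞ M] (g : Metric n M) (x : M) (r : ℕ) : Prop :=
  ∀ φ : OpenPartialHomeomorph M (Model n), IsSmoothChart φ → x ∈ φ.source →
    (ricciOperator g φ (φ x)).rank = r

/-- The velocity `γ'(t)`, as a point of the tangent bundle. -/
def velocity (γ : ℝ → M) (t : ℝ) : TangentBundle (𝓡 n) M :=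
  ⟨γ t, mfderiv 𝓘(ℝ, ℝ) (𝓡 n) γ t (1 : ℝ)⟩

/-- The components of `γ'(t)` in the chart `φ`. -/
def coordVelocity (φ : OpenPartialHomeomorph M (Model n)) (γ : ℝ → M) (t : ℝ) : Fin n → ℝ :=
  fun k => deriv (fun s => φ (γ s) k) t

/-- `γ` is a geodesic on the open interval `(-ε, ε)`: it is smooth there and satisfies
`∇_{γ'} γ' = 0`, written in all smooth charts. -/
def IsGeodesicOn [IsManifold (𝓡 n) ∞ M] (g : Metric n M) (γ : ℝ → M) (ε : ℝ) : Prop :=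
  ContMDiffOn 𝓘(ℝ, ℝ) (𝓡 n) ∞ γ (Set.Ioo (-ε) ε) ∧
  ∀ φ : OpenPartialHomeomorph M (Model n), IsSmoothChart φ →
    ∀ t ∈ Set.Ioo (-ε) ε, γ t ∈ φ.source → ∀ k : Fin n,
      deriv (fun s => coordVelocity φ γ s k) t
        + ∑ i, ∑ j, christoffel g φ k i j (φ (γ t)) *
            coordVelocity φ γ t i * coordVelocity φ γ t j = 0

/-- The matrix, in the basis `∂₁, …, ∂ₙ` of `φ`, of an endomorphism field
`u(t) ∈ End (T_{γ(t)} M)` along `γ`. -/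
def endoMatrix (φ : OpenPartialHomeomorph M (Model n)) (γ : ℝ → M)
    (u : ∀ t : ℝ, TangentSpace (𝓡 n) (γ t) →ₗ[ℝ] TangentSpace (𝓡 n) (γ t)) (t : ℝ) :
    Matrix (Fin n) (Fin n) ℝ :=
  Matrix.of fun i j => component φ (γ t) (u t (coordVector φ (γ t) j)) i

/-- The matrix of the covariant derivative `u' = ∇_{γ'} u` along `γ`:
`(u')ⁱⱼ = d/dt uⁱⱼ + Γⁱ_{kl} (γ')ᵏ uˡⱼ - Γˡ_{kj} (γ')ᵏ uⁱₗ`. -/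
def covDerivEndo [IsManifold (𝓡 n) ∞ M] (g : Metric n M)
    (φ : OpenPartialHomeomorph M (Model n)) (γ : ℝ → M)
    (u : ∀ t : ℝ, TangentSpace (𝓡 n) (γ t) →ₗ[ℝ] TangentSpace (𝓡 n) (γ t)) (t : ℝ) :
    Matrix (Fin n) (Fin n) ℝ :=
  Matrix.of fun i j =>
    deriv (fun s => endoMatrix φ γ u s i j) t
      + ∑ k, ∑ l, coordVelocity φ γ t k *
          (christoffel g φ i k l (φ (γ t)) * endoMatrix φ γ u t l j
            - christoffel g φ l k j (φ (γ t)) * endoMatrix φ γ u t i l)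

/-- `u` is a differentiable solution of the Riccati equation `u' + u² + J(γ') = 0` along `γ` on
`(-ε, ε)`, written in all smooth charts. -/
def IsRiccatiSolutionOn [IsManifold (𝓡 n) ∞ M] (g : Metric n M) (γ : ℝ → M) (ε : ℝ)
    (u : ∀ t : ℝ, TangentSpace (𝓡 n) (γ t) →ₗ[ℝ] TangentSpace (𝓡 n) (γ t)) : Prop :=
  ∀ φ : OpenPartialHomeomorph M (Model n), IsSmoothChart φ →
    ∀ t ∈ Set.Ioo (-ε) ε, γ t ∈ φ.source →
      (∀ i j, DifferentiableAt ℝ (fun s => endoMatrix φ γ u s i j) t) ∧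
      covDerivEndo g φ γ u t + endoMatrix φ γ u t * endoMatrix φ γ u t
        + jacobiOperator g φ (φ (γ t)) (coordVelocity φ γ t) = 0

/-- The algebraic constraint on `(-ε, ε)`: `u(t)` is `g`-symmetric and trace-free, and
`u(t) γ'(t) = 0`. -/
def IsConstrainedOn [IsManifold (𝓡 n) ∞ M] (g : Metric n M) (γ : ℝ → M) (ε : ℝ)
    (u : ∀ t : ℝ, TangentSpace (𝓡 n) (γ t) →ₗ[ℝ] TangentSpace (𝓡 n) (γ t)) : Prop :=
  ∀ t ∈ Set.Ioo (-ε) ε,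
    (∀ a b : TangentSpace (𝓡 n) (γ t), g.inner (γ t) (u t a) b = g.inner (γ t) a (u t b)) ∧
    LinearMap.trace ℝ (TangentSpace (𝓡 n) (γ t)) (u t) = 0 ∧
    u t (velocity (n := n) γ t).2 = 0

/-- Through every point `z = (p, v)` of the unit sphere bundle `SM` there is a short time geodesic
carrying a solution of the Riccati equation that satisfies the algebraic constraint. -/
def AdmitsConstrainedRiccatiSolutions [IsManifold (𝓡 n) ∞ M] (g : Metric n M) : Prop :=
  ∀ z : TangentBundle (𝓡 n) M, g.inner z.1 z.2 z.2 = 1 →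
    ∃ ε : ℝ, 0 < ε ∧ ∃ γ : ℝ → M,
      IsGeodesicOn g γ ε ∧ velocity γ 0 = z ∧
      ∃ u : ∀ t : ℝ, TangentSpace (𝓡 n) (γ t) →ₗ[ℝ] TangentSpace (𝓡 n) (γ t),
        IsRiccatiSolutionOn g γ ε u ∧ IsConstrainedOn g γ ε u

end RiccatiGeometry

end

open scoped Manifold ContDiff

noncomputable section

namespace RiccatiGeometry

open Matrix Filter Topology

/-! Taking the trace of the Riccati equation along the geodesic kills `u'`, because `tr u = 0`, and
leaves `tr (u²) = -ric(γ', γ')` (`trace_sq`). Evaluating and differentiating this at `t = 0` gives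
pointwise conditions on `∇ ric`. In dimension three the Ricci form determines the Jacobi operators
(`frame_jacobi_of_ricci_diagonal`), so those conditions can be computed explicitly. At a point where
the rank is one, take an orthonormal frame `f₀, f₁, f₂` in which `ric` is `μ` times the square of
the covector dual to `f₀`, with `μ ≠ 0`.

For `v = f₀`, the first derivative of the trace identity equates `-(∇_v ric)(v, v)` with `2 tr(u u')
= -2 tr(u³) - 2 tr(u J)`. Both traces vanish: `tr u³ = 3 det u`, and `u` has a kernel; moreover `J`
is `μ/2` times the identity on `f₀^⊥`, so `tr(u J) = (μ/2) tr u`. Hence `(∇_{f₀} ric)(f₀, f₀) = 0`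
(`nablaForm_ricci_axis`).

For a unit `v ⊥ f₀`, `ric(v, v) = 0` forces the symmetric `u(0)` to vanish, so `u'(0) = -J`. Rank
one on an open set gives `ric(a, a) ric(e, e) = ric(a, e)²` there. The trace identity times `ric(e,
e)`, with `e = f₀`, then becomes `tr(u²) ric(e, e) = -ric(γ', e)²`. Its `t²` coefficients yield
`Q(v)² = -μ³/2` for `Q(v) = (∇_v ric)(v, f₀)` (`nablaForm_ricci_perp`).

Finally, the contracted Bianchi identity at `f₀` says that `Q` is trace-free on `f₀^⊥`: the other
terms vanish by the axis computation and because `(∇_x ric)(f, f) = 0` for `f` in the kernel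
(`nablaForm_kernel_self`). A trace-free quadratic form on a plane has a zero on the unit circle,
whereas `Q²` is a non-zero constant there (`false_of_ricci_rank_one`). The remaining lemmas work in
one chart, where the connection is a family of matrices, and translate the intrinsic hypotheses into
that chart. -/

variable {n : ℕ}

/-! ### Calculus of smooth matrix fields on open sets of `ℝⁿ`. -/

section MatrixCalculus

/-- Entrywise smoothness of a matrix field on a set. -/
def SmoothMatrixOn (A : Model n → Matrix (Fin n) (Fin n) ℝ) (V : Set (Model n)) : Prop :=
  ∀ a b, ContDiffOn ℝ ∞ (fun z => A z a b) V

/-- Entrywise partial derivative of a matrix field. -/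
def matrixDeriv (i : Fin n) (A : Model n → Matrix (Fin n) (Fin n) ℝ) (y : Model n) :
    Matrix (Fin n) (Fin n) ℝ :=
  Matrix.of fun a b => partialDeriv i (fun z => A z a b) y

theorem matrixDeriv_apply (i : Fin n) (A : Model n → Matrix (Fin n) (Fin n) ℝ) (y : Model n)
    (a b : Fin n) : matrixDeriv i A y a b = partialDeriv i (fun z => A z a b) y := rfl

variable {V : Set (Model n)} {y : Model n}

theorem contDiffOn_partialDeriv (hV : IsOpen V) {f : Model n → ℝ} (hf : ContDiffOn ℝ ∞ f V)
    (i : Fin n) : ContDiffOn ℝ ∞ (fun z => partialDeriv i f z) V :=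
  (hf.fderiv_of_isOpen hV (m := ∞) (by simp)).clm_apply contDiffOn_const

theorem differentiableAt_of_contDiffOn (hV : IsOpen V) (hy : y ∈ V) {f : Model n → ℝ}
    (hf : ContDiffOn ℝ ∞ f V) : DifferentiableAt ℝ f y :=
  (hf.contDiffAt (hV.mem_nhds hy)).differentiableAt (by simp)

theorem partialDeriv_comm (hV : IsOpen V) (hy : y ∈ V) {f : Model n → ℝ}
    (hf : ContDiffOn ℝ ∞ f V) (i j : Fin n) :
    partialDeriv i (fun z => partialDeriv j f z) y
      = partialDeriv j (fun z => partialDeriv i f z) y := by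
  have hd : DifferentiableAt ℝ (fderiv ℝ f) y :=
    ((hf.fderiv_of_isOpen hV (m := ∞) (by simp)).contDiffAt (hV.mem_nhds hy)).differentiableAt
      (by simp)
  have hs : IsSymmSndFDerivAt ℝ f y :=
    (hf.contDiffAt (hV.mem_nhds hy)).isSymmSndFDerivAt (by simp; exact WithTop.coe_le_coe.2 le_top)
  unfold partialDeriv
  rw [fderiv_clm_apply hd (differentiableAt_const _),
    fderiv_clm_apply hd (differentiableAt_const _)]
  simpa using hs.eq _ _

theorem SmoothMatrixOn.matrixDeriv (hV : IsOpen V) {A : Model n → Matrix (Fin n) (Fin n) ℝ}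
    (hA : SmoothMatrixOn A V) (i : Fin n) : SmoothMatrixOn (matrixDeriv i A) V :=
  fun a b => contDiffOn_partialDeriv hV (hA a b) i

theorem SmoothMatrixOn.add {A B : Model n → Matrix (Fin n) (Fin n) ℝ}
    (hA : SmoothMatrixOn A V) (hB : SmoothMatrixOn B V) :
    SmoothMatrixOn (fun z => A z + B z) V :=
  fun a b => (hA a b).add (hB a b)

theorem SmoothMatrixOn.sub {A B : Model n → Matrix (Fin n) (Fin n) ℝ}
    (hA : SmoothMatrixOn A V) (hB : SmoothMatrixOn B V) :
    SmoothMatrixOn (fun z => A z - B z) V :=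
  fun a b => (hA a b).sub (hB a b)

theorem SmoothMatrixOn.transpose {A : Model n → Matrix (Fin n) (Fin n) ℝ}
    (hA : SmoothMatrixOn A V) : SmoothMatrixOn (fun z => (A z)ᵀ) V :=
  fun a b => hA b a

theorem SmoothMatrixOn.mul {A B : Model n → Matrix (Fin n) (Fin n) ℝ}
    (hA : SmoothMatrixOn A V) (hB : SmoothMatrixOn B V) :
    SmoothMatrixOn (fun z => A z * B z) V := by
  intro a b
  simp only [Matrix.mul_apply]
  exact ContDiffOn.sum fun k _ => (hA a k).mul (hB k b)

theorem SmoothMatrixOn.det {A : Model n → Matrix (Fin n) (Fin n) ℝ}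
    (hA : SmoothMatrixOn A V) : ContDiffOn ℝ ∞ (fun z => (A z).det) V := by
  simp only [Matrix.det_apply']
  exact ContDiffOn.sum fun σ _ =>
    contDiffOn_const.mul (contDiffOn_prod fun i _ => hA (σ i) i)

theorem SmoothMatrixOn.inv {A : Model n → Matrix (Fin n) (Fin n) ℝ}
    (hA : SmoothMatrixOn A V) (hdet : ∀ z ∈ V, (A z).det ≠ 0) :
    SmoothMatrixOn (fun z => (A z)⁻¹) V := by
  intro a b
  have hadj : ContDiffOn ℝ ∞ (fun z => (A z).adjugate a b) V := by
    simp only [Matrix.adjugate_apply]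
    refine SmoothMatrixOn.det (A := fun z => (A z).updateRow b (Pi.single a 1)) fun i j => ?_
    by_cases h : i = b
    · subst h
      simpa using contDiffOn_const
    · simpa [Matrix.updateRow_ne h] using hA i j
  refine ((hA.det.inv hdet).mul hadj).congr fun z _ => ?_
  simp [Matrix.inv_def]

theorem SmoothMatrixOn.differentiableAt (hV : IsOpen V) (hy : y ∈ V)
    {A : Model n → Matrix (Fin n) (Fin n) ℝ} (hA : SmoothMatrixOn A V) (a b : Fin n) :
    DifferentiableAt ℝ (fun z => A z a b) y :=
  differentiableAt_of_contDiffOn hV hy (hA a b)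

theorem matrixDeriv_comm (hV : IsOpen V) (hy : y ∈ V) {A : Model n → Matrix (Fin n) (Fin n) ℝ}
    (hA : SmoothMatrixOn A V) (i j : Fin n) :
    matrixDeriv i (matrixDeriv j A) y = matrixDeriv j (matrixDeriv i A) y := by
  ext a b
  exact partialDeriv_comm hV hy (hA a b) i j

theorem matrixDeriv_congr (hV : IsOpen V) (hy : y ∈ V) {A B : Model n → Matrix (Fin n) (Fin n) ℝ}
    (h : ∀ z ∈ V, A z = B z) (i : Fin n) : matrixDeriv i A y = matrixDeriv i B y := by
  ext a b
  simp only [matrixDeriv_apply, partialDeriv]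
  rw [Filter.EventuallyEq.fderiv_eq]
  filter_upwards [hV.mem_nhds hy] with z hz
  rw [h z hz]

theorem matrixDeriv_transpose (i : Fin n) (A : Model n → Matrix (Fin n) (Fin n) ℝ) (y : Model n) :
    matrixDeriv i (fun z => (A z)ᵀ) y = (matrixDeriv i A y)ᵀ := rfl

theorem matrixDeriv_zero (i : Fin n) :
    matrixDeriv i (fun _ => (0 : Matrix (Fin n) (Fin n) ℝ)) y = 0 := by
  ext a b
  simp [matrixDeriv_apply, partialDeriv]

theorem matrixDeriv_add (hV : IsOpen V) (hy : y ∈ V) {A B : Model n → Matrix (Fin n) (Fin n) ℝ}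
    (hA : SmoothMatrixOn A V) (hB : SmoothMatrixOn B V) (i : Fin n) :
    matrixDeriv i (fun z => A z + B z) y = matrixDeriv i A y + matrixDeriv i B y := by
  ext a b
  simp only [matrixDeriv_apply, partialDeriv, Matrix.add_apply]
  rw [fderiv_fun_add (hA.differentiableAt hV hy a b) (hB.differentiableAt hV hy a b)]
  rfl

theorem matrixDeriv_sub (hV : IsOpen V) (hy : y ∈ V) {A B : Model n → Matrix (Fin n) (Fin n) ℝ}
    (hA : SmoothMatrixOn A V) (hB : SmoothMatrixOn B V) (i : Fin n) :
    matrixDeriv i (fun z => A z - B z) y = matrixDeriv i A y - matrixDeriv i B y := by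
  ext a b
  simp only [matrixDeriv_apply, partialDeriv, Matrix.sub_apply]
  rw [fderiv_fun_sub (hA.differentiableAt hV hy a b) (hB.differentiableAt hV hy a b)]
  rfl

theorem matrixDeriv_mul (hV : IsOpen V) (hy : y ∈ V) {A B : Model n → Matrix (Fin n) (Fin n) ℝ}
    (hA : SmoothMatrixOn A V) (hB : SmoothMatrixOn B V) (i : Fin n) :
    matrixDeriv i (fun z => A z * B z) y = matrixDeriv i A y * B y + A y * matrixDeriv i B y := by
  ext a b
  simp only [matrixDeriv_apply, partialDeriv, Matrix.mul_apply, Matrix.add_apply]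
  rw [fderiv_fun_sum fun k _ =>
    (hA.differentiableAt hV hy a k).fun_mul (hB.differentiableAt hV hy k b)]
  rw [_root_.sum_apply, ← Finset.sum_add_distrib]
  refine Finset.sum_congr rfl fun k _ => ?_
  rw [fderiv_fun_mul (hA.differentiableAt hV hy a k) (hB.differentiableAt hV hy k b)]
  simp
  ring

end MatrixCalculus

/-! ### Curvature of a metric connection in matrix form, and the Bianchi identities. -/

section LeviCivita

/-- `Γ` is the family of connection matrices `(Γ i)ᵏⱼ = Γᵏ_{ij}` of the Levi-Civita connection of
the metric `G` on the open set `V`. -/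
structure IsLeviCivitaOn (V : Set (Model n)) (G : Model n → Matrix (Fin n) (Fin n) ℝ)
    (Γ : Fin n → Model n → Matrix (Fin n) (Fin n) ℝ) : Prop where
  isOpen : IsOpen V
  smooth_metric : SmoothMatrixOn G V
  smooth_conn : ∀ i, SmoothMatrixOn (Γ i) V
  symm : ∀ y ∈ V, (G y)ᵀ = G y
  posDef : ∀ y ∈ V, (G y).PosDef
  torsionFree : ∀ y ∈ V, ∀ k i j, Γ i y k j = Γ j y k i
  compatible : ∀ y ∈ V, ∀ i, matrixDeriv i G y = (Γ i y)ᵀ * G y + G y * Γ i y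

/-- The curvature matrices `R(∂ᵢ, ∂ⱼ)` of the connection matrices `Γ`. -/
def curvature (Γ : Fin n → Model n → Matrix (Fin n) (Fin n) ℝ) (i j : Fin n) (y : Model n) :
    Matrix (Fin n) (Fin n) ℝ :=
  matrixDeriv i (Γ j) y - matrixDeriv j (Γ i) y + (Γ i y * Γ j y - Γ j y * Γ i y)

/-- The Ricci form of the connection matrices `Γ`. -/
def ricci (Γ : Fin n → Model n → Matrix (Fin n) (Fin n) ℝ) (y : Model n) :
    Matrix (Fin n) (Fin n) ℝ :=
  Matrix.of fun j k => ∑ i, curvature Γ i j y i k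

/-- The covariant derivative `∇ₘ A` of an endomorphism valued field. -/
def covDerivEnd (Γ : Fin n → Model n → Matrix (Fin n) (Fin n) ℝ) (m : Fin n)
    (A : Model n → Matrix (Fin n) (Fin n) ℝ) (y : Model n) : Matrix (Fin n) (Fin n) ℝ :=
  matrixDeriv m A y + (Γ m y * A y - A y * Γ m y)

/-- The covariant derivative `∇ₘ S` of a bilinear form. -/
def covDerivForm (Γ : Fin n → Model n → Matrix (Fin n) (Fin n) ℝ) (m : Fin n)
    (S : Model n → Matrix (Fin n) (Fin n) ℝ) (y : Model n) : Matrix (Fin n) (Fin n) ℝ :=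
  matrixDeriv m S y - (Γ m y)ᵀ * S y - S y * Γ m y

/-- The covariant derivative `(∇ₘ R)(∂ᵢ, ∂ⱼ)` of the curvature tensor. -/
def covDerivCurvature (Γ : Fin n → Model n → Matrix (Fin n) (Fin n) ℝ) (m i j : Fin n)
    (y : Model n) : Matrix (Fin n) (Fin n) ℝ :=
  covDerivEnd Γ m (curvature Γ i j) y
    - ∑ a, (Γ m y a i • curvature Γ a j y + Γ m y a j • curvature Γ i a y)

variable {V : Set (Model n)} {G : Model n → Matrix (Fin n) (Fin n) ℝ}
  {Γ : Fin n → Model n → Matrix (Fin n) (Fin n) ℝ} {y : Model n}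

theorem curvature_swap (i j : Fin n) : curvature Γ j i y = - curvature Γ i j y := by
  unfold curvature
  abel

theorem covDerivCurvature_swap (m i j : Fin n) :
    covDerivCurvature Γ m j i y = - covDerivCurvature Γ m i j y := by
  have h : curvature Γ j i = fun z => - curvature Γ i j z := funext fun z => curvature_swap i j
  have hd : matrixDeriv m (fun z => - curvature Γ i j z) y
      = - matrixDeriv m (curvature Γ i j) y := by
    ext a b
    simp [matrixDeriv_apply, partialDeriv]
  have hs : ∑ a, (Γ m y a j • curvature Γ a i y + Γ m y a i • curvature Γ j a y)
      = - ∑ a, (Γ m y a i • curvature Γ a j y + Γ m y a j • curvature Γ i a y) := by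
    rw [← Finset.sum_neg_distrib]
    refine Finset.sum_congr rfl fun a _ => ?_
    rw [curvature_swap i a, curvature_swap a j, smul_neg, smul_neg]
    abel
  unfold covDerivCurvature covDerivEnd
  rw [hs, h, hd]
  simp only [mul_neg, neg_mul]
  abel

namespace IsLeviCivitaOn

theorem smooth_curvature (h : IsLeviCivitaOn V G Γ) (i j : Fin n) :
    SmoothMatrixOn (curvature Γ i j) V :=
  (((h.smooth_conn j).matrixDeriv h.isOpen i).sub ((h.smooth_conn i).matrixDeriv h.isOpen j)).add
    (((h.smooth_conn i).mul (h.smooth_conn j)).sub ((h.smooth_conn j).mul (h.smooth_conn i)))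

theorem smooth_ricci (h : IsLeviCivitaOn V G Γ) : SmoothMatrixOn (ricci Γ) V :=
  fun j k => by
    simp only [ricci, Matrix.of_apply]
    exact ContDiffOn.sum fun i _ => h.smooth_curvature i j i k

/-- Mixed second derivatives of the metric commute; expanding both of them through metric
compatibility leaves exactly this expression. -/
theorem curvature_skew (h : IsLeviCivitaOn V G Γ) (hy : y ∈ V) (i j : Fin n) :
    (curvature Γ i j y)ᵀ * G y + G y * curvature Γ i j y = 0 := by
  have key : ∀ i j, matrixDeriv i (matrixDeriv j G) y
      = (matrixDeriv i (Γ j) y)ᵀ * G y + (Γ j y)ᵀ * ((Γ i y)ᵀ * G y + G y * Γ i y)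
        + (((Γ i y)ᵀ * G y + G y * Γ i y) * Γ j y + G y * matrixDeriv i (Γ j) y) := by
    intro i j
    rw [matrixDeriv_congr h.isOpen hy (fun z hz => h.compatible z hz j),
      matrixDeriv_add h.isOpen hy ((h.smooth_conn j).transpose.mul h.smooth_metric)
        (h.smooth_metric.mul (h.smooth_conn j)),
      matrixDeriv_mul h.isOpen hy (h.smooth_conn j).transpose h.smooth_metric,
      matrixDeriv_mul h.isOpen hy h.smooth_metric (h.smooth_conn j),
      matrixDeriv_transpose, h.compatible y hy i]
  have hc := matrixDeriv_comm h.isOpen hy h.smooth_metric i j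
  rw [key, key] at hc
  rw [← sub_eq_zero] at hc
  rw [← hc]
  simp only [curvature, transpose_add, transpose_sub, transpose_mul]
  noncomm_ring

/-- The metric is parallel, so `curvature_skew` may be differentiated covariantly; the connection
terms are multiples of the undifferentiated identity. -/
theorem covDerivEnd_curvature_skew (h : IsLeviCivitaOn V G Γ) (hy : y ∈ V) (m i j : Fin n) :
    (covDerivEnd Γ m (curvature Γ i j) y)ᵀ * G y + G y * covDerivEnd Γ m (curvature Γ i j) y
      = 0 := by
  have hd := matrixDeriv_congr h.isOpen hy (fun z hz => h.curvature_skew hz i j) m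
  rw [matrixDeriv_zero,
    matrixDeriv_add h.isOpen hy ((h.smooth_curvature i j).transpose.mul h.smooth_metric)
      (h.smooth_metric.mul (h.smooth_curvature i j)),
    matrixDeriv_mul h.isOpen hy (h.smooth_curvature i j).transpose h.smooth_metric,
    matrixDeriv_mul h.isOpen hy h.smooth_metric (h.smooth_curvature i j),
    matrixDeriv_transpose, h.compatible y hy m] at hd
  have hs := h.curvature_skew hy i j
  have h1 : (Γ m y)ᵀ * ((curvature Γ i j y)ᵀ * G y + G y * curvature Γ i j y) = 0 := by
    rw [hs, mul_zero]
  have h2 : ((curvature Γ i j y)ᵀ * G y + G y * curvature Γ i j y) * Γ m y = 0 := by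
    rw [hs, zero_mul]
  have hsum : ∀ X D Y Z : Matrix (Fin n) (Fin n) ℝ, D = 0 → Y = 0 → Z = 0 → X = D - Y - Z →
      X = 0 := by
    rintro X D Y Z rfl rfl rfl rfl
    simp
  refine hsum _ _ _ _ hd h1 h2 ?_
  simp only [covDerivEnd, transpose_add, transpose_sub, transpose_mul]
  noncomm_ring

theorem covDerivCurvature_skew (h : IsLeviCivitaOn V G Γ) (hy : y ∈ V) (m i j : Fin n) :
    (covDerivCurvature Γ m i j y)ᵀ * G y + G y * covDerivCurvature Γ m i j y = 0 := by
  have hs : (∑ a, (Γ m y a i • curvature Γ a j y + Γ m y a j • curvature Γ i a y))ᵀ * G y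
      + G y * ∑ a, (Γ m y a i • curvature Γ a j y + Γ m y a j • curvature Γ i a y) = 0 := by
    rw [transpose_sum, Finset.sum_mul, Finset.mul_sum, ← Finset.sum_add_distrib]
    refine Finset.sum_eq_zero fun a _ => ?_
    have h1 := h.curvature_skew hy a j
    have h2 := h.curvature_skew hy i a
    simp only [transpose_add, transpose_smul, add_mul, mul_add, smul_mul_assoc, mul_smul_comm]
    rw [add_add_add_comm, ← smul_add, ← smul_add, h1, h2, smul_zero, smul_zero, add_zero]
  have h0 := h.covDerivEnd_curvature_skew hy m i j
  unfold covDerivCurvature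
  rw [transpose_sub, sub_mul, mul_sub, sub_add_sub_comm, h0, hs, sub_zero]

/-- For the endomorphism part, second derivatives cancel by symmetry and the products in `Γ` cancel
as in the Jacobi identity. The corrections on the two form indices cancel separately, by
torsion-freeness and antisymmetry. -/
theorem bianchi_second (h : IsLeviCivitaOn V G Γ) (hy : y ∈ V) (m i j : Fin n) :
    covDerivCurvature Γ m i j y + covDerivCurvature Γ i j m y + covDerivCurvature Γ j m i y
      = 0 := by
  have hR : ∀ m i j, matrixDeriv m (curvature Γ i j) y
      = matrixDeriv m (matrixDeriv i (Γ j)) y - matrixDeriv m (matrixDeriv j (Γ i)) y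
        + ((matrixDeriv m (Γ i) y * Γ j y + Γ i y * matrixDeriv m (Γ j) y)
          - (matrixDeriv m (Γ j) y * Γ i y + Γ j y * matrixDeriv m (Γ i) y)) := by
    intro m i j
    have hs := h.smooth_conn
    have hd : ∀ i j, SmoothMatrixOn (matrixDeriv i (Γ j)) V :=
      fun i j => (hs j).matrixDeriv h.isOpen i
    unfold curvature
    rw [matrixDeriv_add h.isOpen hy ((hd i j).sub (hd j i))
        (((hs i).mul (hs j)).sub ((hs j).mul (hs i))),
      matrixDeriv_sub h.isOpen hy (hd i j) (hd j i),
      matrixDeriv_sub h.isOpen hy ((hs i).mul (hs j)) ((hs j).mul (hs i)),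
      matrixDeriv_mul h.isOpen hy (hs i) (hs j), matrixDeriv_mul h.isOpen hy (hs j) (hs i)]
  have hE : covDerivEnd Γ m (curvature Γ i j) y + covDerivEnd Γ i (curvature Γ j m) y
      + covDerivEnd Γ j (curvature Γ m i) y = 0 := by
    unfold covDerivEnd
    rw [hR, hR, hR, matrixDeriv_comm h.isOpen hy (h.smooth_conn j) m i,
      matrixDeriv_comm h.isOpen hy (h.smooth_conn m) i j,
      matrixDeriv_comm h.isOpen hy (h.smooth_conn i) j m]
    simp only [curvature]
    noncomm_ring
  have hS : ∑ a, (Γ m y a i • curvature Γ a j y + Γ m y a j • curvature Γ i a y)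
      + ∑ a, (Γ i y a j • curvature Γ a m y + Γ i y a m • curvature Γ j a y)
      + ∑ a, (Γ j y a m • curvature Γ a i y + Γ j y a i • curvature Γ m a y) = 0 := by
    rw [← Finset.sum_add_distrib, ← Finset.sum_add_distrib]
    refine Finset.sum_eq_zero fun a _ => ?_
    rw [h.torsionFree y hy a i m, h.torsionFree y hy a j i, h.torsionFree y hy a m j,
      curvature_swap j a, curvature_swap a i, curvature_swap a m]
    simp only [smul_neg]
    abel
  unfold covDerivCurvature
  have hsub : ∀ X E S : Matrix (Fin n) (Fin n) ℝ, E = 0 → S = 0 → X = E - S → X = 0 := by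
    rintro X E S rfl rfl rfl
    simp
  refine hsub _ _ _ hE hS ?_
  abel

theorem bianchi_first (h : IsLeviCivitaOn V G Γ) (hy : y ∈ V) (l i j k : Fin n) :
    curvature Γ i j y l k + curvature Γ j k y l i + curvature Γ k i y l j = 0 := by
  have hd : ∀ i j k, matrixDeriv i (Γ j) y l k = matrixDeriv i (Γ k) y l j := by
    intro i j k
    simp only [matrixDeriv_apply, partialDeriv]
    rw [Filter.EventuallyEq.fderiv_eq]
    filter_upwards [h.isOpen.mem_nhds hy] with z hz
    exact h.torsionFree z hz l j k
  have hm : ∀ i j k, (Γ i y * Γ j y) l k = (Γ i y * Γ k y) l j := by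
    intro i j k
    simp only [Matrix.mul_apply]
    exact Finset.sum_congr rfl fun a _ => by rw [h.torsionFree y hy a j k]
  simp only [curvature, Matrix.add_apply, Matrix.sub_apply]
  rw [hd i j k, hd j i k, hd k i j, hm i j k, hm j i k, hm k i j]
  ring

/-- Contraction commutes with `∇`: the connection terms on the two contracted indices cancel, and
the other two are those of the Ricci form. -/
theorem covDerivForm_ricci (h : IsLeviCivitaOn V G Γ) (hy : y ∈ V) (m j k : Fin n) :
    covDerivForm Γ m (ricci Γ) y j k = ∑ i, covDerivCurvature Γ m i j y i k := by
  have h1 : matrixDeriv m (ricci Γ) y j k = ∑ i, matrixDeriv m (curvature Γ i j) y i k := by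
    simp only [matrixDeriv_apply, partialDeriv, ricci, Matrix.of_apply]
    rw [fderiv_fun_sum fun i _ => (h.smooth_curvature i j).differentiableAt h.isOpen hy i k,
      _root_.sum_apply]
  have h2 : ∑ i, (Γ m y * curvature Γ i j y) i k = ∑ i, ∑ a, Γ m y a i * curvature Γ a j y i k := by
    simp only [Matrix.mul_apply]
    rw [Finset.sum_comm]
  have h3 : ∑ i, (curvature Γ i j y * Γ m y) i k = (ricci Γ y * Γ m y) j k := by
    simp only [Matrix.mul_apply, ricci, Matrix.of_apply, Finset.sum_mul]
    rw [Finset.sum_comm]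
  have h4 : ∑ i, ∑ a, Γ m y a j * curvature Γ i a y i k = ((Γ m y)ᵀ * ricci Γ y) j k := by
    simp only [Matrix.mul_apply, ricci, Matrix.of_apply, Finset.mul_sum, Matrix.transpose_apply]
    rw [Finset.sum_comm]
  simp only [covDerivForm, covDerivCurvature, covDerivEnd, Matrix.sub_apply, Matrix.add_apply,
    Matrix.sum_apply, Matrix.smul_apply, smul_eq_mul, Finset.sum_sub_distrib,
    Finset.sum_add_distrib]
  rw [h1, h2, h3, h4]
  ring

theorem isUnit_det (h : IsLeviCivitaOn V G Γ) (hy : y ∈ V) : IsUnit (G y).det :=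
  (h.posDef y hy).det_pos.ne'.isUnit

theorem inv_symm (h : IsLeviCivitaOn V G Γ) (hy : y ∈ V) (i j : Fin n) :
    (G y)⁻¹ i j = (G y)⁻¹ j i := by
  have := Matrix.transpose_nonsing_inv (G y)
  rw [h.symm y hy] at this
  exact congrFun (congrFun this j) i

/-- Raising an index turns a skew-adjoint endomorphism into an antisymmetric matrix. -/
theorem mul_inv_skew (h : IsLeviCivitaOn V G Γ) (hy : y ∈ V)
    {A : Matrix (Fin n) (Fin n) ℝ} (hA : Aᵀ * G y + G y * A = 0) (i j : Fin n) :
    (A * (G y)⁻¹) i j = - (A * (G y)⁻¹) j i := by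
  have hu := h.isUnit_det hy
  have hT : (A * (G y)⁻¹)ᵀ = (G y)⁻¹ * Aᵀ := by
    rw [transpose_mul, Matrix.transpose_nonsing_inv, h.symm y hy]
  have h0 : (G y)⁻¹ * (Aᵀ * G y + G y * A) * (G y)⁻¹ = 0 := by rw [hA]; simp
  rw [mul_add, add_mul, Matrix.nonsing_inv_mul_cancel_left _ _ hu, Matrix.mul_assoc,
    Matrix.mul_nonsing_inv_cancel_right _ _ hu, ← hT] at h0
  have := congrFun (congrFun h0 j) i
  simp only [Matrix.add_apply, Matrix.transpose_apply, Matrix.zero_apply] at this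
  linarith

/-- The contracted second Bianchi identity `d (tr ric) = 2 div ric`. -/
theorem bianchi_contracted (h : IsLeviCivitaOn V G Γ) (hy : y ∈ V) (m : Fin n) :
    ∑ j, ∑ k, (G y)⁻¹ j k * covDerivForm Γ m (ricci Γ) y j k
      = 2 * ∑ j, ∑ k, (G y)⁻¹ j k * covDerivForm Γ j (ricci Γ) y m k := by
  simp only [h.covDerivForm_ricci hy]
  have hB : ∑ j, ∑ k, ∑ i, (G y)⁻¹ j k * (covDerivCurvature Γ m i j y i k
      + covDerivCurvature Γ i j m y i k + covDerivCurvature Γ j m i y i k) = 0 := by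
    refine Finset.sum_eq_zero fun j _ => Finset.sum_eq_zero fun k _ =>
      Finset.sum_eq_zero fun i _ => ?_
    have := congrFun (congrFun (h.bianchi_second hy m i j) i) k
    simp only [Matrix.add_apply, Matrix.zero_apply] at this
    rw [this, mul_zero]
  -- After contraction, the last two terms of the second Bianchi identity each equal minus the
  -- divergence of `ric`. Here antisymmetry in the form indices suffices; `h2` uses antisymmetry of
  -- the endomorphism with an index raised, followed by exchanging the names `i` and `j`.
  have h3 : ∑ j, ∑ k, ∑ i, (G y)⁻¹ j k * covDerivCurvature Γ j m i y i k
      = - ∑ j, ∑ k, ∑ i, (G y)⁻¹ j k * covDerivCurvature Γ j i m y i k := by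
    simp only [← Finset.sum_neg_distrib]
    refine Finset.sum_congr rfl fun j _ => Finset.sum_congr rfl fun k _ =>
      Finset.sum_congr rfl fun i _ => ?_
    rw [covDerivCurvature_swap j i m]
    simp
  have h2 : ∑ j, ∑ k, ∑ i, (G y)⁻¹ j k * covDerivCurvature Γ i j m y i k
      = - ∑ j, ∑ k, ∑ i, (G y)⁻¹ j k * covDerivCurvature Γ j i m y i k := by
    have e1 : ∀ i j, ∑ k, (G y)⁻¹ j k * covDerivCurvature Γ i j m y i k
        = (covDerivCurvature Γ i j m y * (G y)⁻¹) i j := by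
      intro i j
      rw [Matrix.mul_apply]
      exact Finset.sum_congr rfl fun k _ => by rw [h.inv_symm hy j k, mul_comm]
    have e2 : ∀ i j, ∑ k, (G y)⁻¹ i k * covDerivCurvature Γ i j m y j k
        = (covDerivCurvature Γ i j m y * (G y)⁻¹) j i := by
      intro i j
      rw [Matrix.mul_apply]
      exact Finset.sum_congr rfl fun k _ => by rw [h.inv_symm hy i k, mul_comm]
    calc ∑ j, ∑ k, ∑ i, (G y)⁻¹ j k * covDerivCurvature Γ i j m y i k
        = ∑ j, ∑ i, ∑ k, (G y)⁻¹ j k * covDerivCurvature Γ i j m y i k :=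
          Finset.sum_congr rfl fun j _ => Finset.sum_comm
      _ = ∑ j, ∑ i, - (covDerivCurvature Γ i j m y * (G y)⁻¹) j i := by
          refine Finset.sum_congr rfl fun j _ => Finset.sum_congr rfl fun i _ => ?_
          rw [e1, h.mul_inv_skew hy (h.covDerivCurvature_skew hy i j m)]
      _ = ∑ i, ∑ j, - ∑ k, (G y)⁻¹ i k * covDerivCurvature Γ i j m y j k := by
          rw [Finset.sum_comm]
          simp only [e2]
      _ = _ := by
          simp only [← Finset.sum_neg_distrib]
          exact Finset.sum_congr rfl fun i _ => Finset.sum_comm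
  simp only [mul_add, Finset.sum_add_distrib] at hB
  rw [h3, h2] at hB
  simp only [Finset.mul_sum] at hB ⊢
  simp only [← Finset.mul_sum] at hB ⊢
  linarith

end IsLeviCivitaOn

end LeviCivita

/-! ### Ricci form and Jacobi operator in an orthonormal frame. -/

/-- The matrix of `x ↦ R(x, v) v` for curvature matrices `R(∂ᵢ, ∂ⱼ)`. -/
def jacobiMatrix (R : Fin n → Fin n → Matrix (Fin n) (Fin n) ℝ) (v : Fin n → ℝ) :
    Matrix (Fin n) (Fin n) ℝ :=
  Matrix.of fun l i => ∑ j, ∑ k, R i j l k * v j * v k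

/-- The curvature matrix `R(f_a, f_b)` for the columns `f_a` of `P`. -/
def frameCurvature (R : Fin n → Fin n → Matrix (Fin n) (Fin n) ℝ) (P : Matrix (Fin n) (Fin n) ℝ)
    (a b : Fin n) : Matrix (Fin n) (Fin n) ℝ :=
  ∑ i, ∑ j, (P i a * P j b) • R i j

section Frame

variable {R : Fin n → Fin n → Matrix (Fin n) (Fin n) ℝ} {G P : Matrix (Fin n) (Fin n) ℝ}

theorem frameCurvature_swap (hR : ∀ i j, R j i = - R i j) (a b : Fin n) :
    frameCurvature R P b a = - frameCurvature R P a b := by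
  unfold frameCurvature
  rw [Finset.sum_comm, ← Finset.sum_neg_distrib]
  refine Finset.sum_congr rfl fun i _ => ?_
  rw [← Finset.sum_neg_distrib]
  refine Finset.sum_congr rfl fun j _ => ?_
  rw [hR i j, smul_neg, mul_comm]

theorem frameCurvature_skew (hskew : ∀ i j, (R i j)ᵀ * G + G * R i j = 0) (hG : Gᵀ = G)
    (a b c d : Fin n) :
    (Pᵀ * G * frameCurvature R P a b * P) c d = - (Pᵀ * G * frameCurvature R P a b * P) d c := by
  have h0 : (frameCurvature R P a b)ᵀ * G + G * frameCurvature R P a b = 0 := by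
    simp only [frameCurvature, transpose_sum, transpose_smul, Finset.sum_mul, Finset.mul_sum,
      ← Finset.sum_add_distrib, smul_mul_assoc, mul_smul_comm, ← smul_add, hskew, smul_zero,
      Finset.sum_const_zero]
  have h1 : (Pᵀ * G * frameCurvature R P a b * P)ᵀ + Pᵀ * G * frameCurvature R P a b * P = 0 := by
    have : (Pᵀ * G * frameCurvature R P a b * P)ᵀ + Pᵀ * G * frameCurvature R P a b * P
        = Pᵀ * ((frameCurvature R P a b)ᵀ * G + G * frameCurvature R P a b) * P := by
      simp only [transpose_mul, transpose_transpose, hG]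
      noncomm_ring
    rw [this, h0]
    simp
  have := congrFun (congrFun h1 d) c
  simp only [Matrix.add_apply, Matrix.transpose_apply, Matrix.zero_apply] at this
  linarith

theorem frame_mul_cancel (hP : Pᵀ * G * P = 1) : P * (Pᵀ * G) = 1 :=
  mul_eq_one_comm.1 hP

/-- `P * (Pᵀ * G) = 1` is the completeness relation of the frame, so the trace defining the Ricci
form may be taken over the frame instead of the coordinate basis. -/
theorem frame_ricci (hP : Pᵀ * G * P = 1) (b c : Fin n) :
    (Pᵀ * (Matrix.of fun j k => ∑ i, R i j i k) * P) b c
      = ∑ a, (Pᵀ * G * frameCurvature R P a b * P) a c := by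
  have h1 : ∀ a, (Pᵀ * G * frameCurvature R P a b * P) a c
      = ∑ i, ∑ j, P j b * (P i a * (Pᵀ * G * R i j * P) a c) := by
    intro a
    simp only [frameCurvature, Finset.mul_sum, Finset.sum_mul, mul_smul_comm, smul_mul_assoc,
      Matrix.sum_apply, Matrix.smul_apply, smul_eq_mul]
    exact Finset.sum_congr rfl fun i _ => Finset.sum_congr rfl fun j _ => by ring
  have h2 : ∀ i j, ∑ a, P i a * (Pᵀ * G * R i j * P) a c = (R i j * P) i c := by
    intro i j
    rw [← Matrix.mul_apply, Matrix.mul_assoc (Pᵀ * G), ← Matrix.mul_assoc P, frame_mul_cancel hP,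
      Matrix.one_mul]
  have h3 : ∑ a, (Pᵀ * G * frameCurvature R P a b * P) a c
      = ∑ i, ∑ j, P j b * (R i j * P) i c := by
    simp only [h1]
    rw [Finset.sum_comm]
    refine Finset.sum_congr rfl fun i _ => ?_
    rw [Finset.sum_comm]
    refine Finset.sum_congr rfl fun j _ => ?_
    rw [← h2, Finset.mul_sum]
  rw [h3, Matrix.mul_assoc, Matrix.mul_apply, Finset.sum_comm]
  refine Finset.sum_congr rfl fun j _ => ?_
  rw [← Finset.mul_sum, Matrix.transpose_apply]
  congr 1
  simp only [Matrix.mul_apply, Matrix.of_apply, Finset.sum_mul]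
  rw [Finset.sum_comm]

theorem frame_jacobi (a b d : Fin n) :
    (Pᵀ * G * jacobiMatrix R (fun i => P i b) * P) d a
      = (Pᵀ * G * frameCurvature R P a b * P) d b := by
  rw [Matrix.mul_assoc (Pᵀ * G), Matrix.mul_assoc (Pᵀ * G), Matrix.mul_apply, Matrix.mul_apply]
  refine Finset.sum_congr rfl fun l _ => ?_
  congr 1
  simp only [Matrix.mul_apply, jacobiMatrix, frameCurvature, Matrix.of_apply, Matrix.sum_apply,
    Matrix.smul_apply, smul_eq_mul, Finset.sum_mul]
  conv_rhs => rw [Finset.sum_comm]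
  refine Finset.sum_congr rfl fun i _ => ?_
  conv_rhs => rw [Finset.sum_comm]
  refine Finset.sum_congr rfl fun j _ => Finset.sum_congr rfl fun k _ => ?_
  ring

end Frame

/-- In dimension three the Ricci form determines the Jacobi operators: the case of an orthonormal
frame which diagonalizes the Ricci form. -/
theorem frame_jacobi_of_ricci_diagonal {R : Fin 3 → Fin 3 → Matrix (Fin 3) (Fin 3) ℝ}
    {G P : Matrix (Fin 3) (Fin 3) ℝ} (hR : ∀ i j, R j i = - R i j)
    (hskew : ∀ i j, (R i j)ᵀ * G + G * R i j = 0) (hG : Gᵀ = G) (hP : Pᵀ * G * P = 1)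
    {s : Fin 3 → ℝ} (hS : Pᵀ * (Matrix.of fun j k => ∑ i, R i j i k) * P = Matrix.diagonal s) :
    Pᵀ * G * jacobiMatrix R (fun i => P i 0) * P
      = Matrix.diagonal ![0, (s 0 + s 1 - s 2) / 2, (s 0 - s 1 + s 2) / 2] := by
  -- `r a b c d` is `⟨R(f_a, f_b) f_c, f_d⟩`.
  obtain ⟨r, hr⟩ : ∃ r : Fin 3 → Fin 3 → Fin 3 → Fin 3 → ℝ,
      r = fun a b c d => (Pᵀ * G * frameCurvature R P a b * P) d c := ⟨_, rfl⟩
  have hab : ∀ a b c d, r b a c d = - r a b c d := by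
    intro a b c d
    simp [hr, frameCurvature_swap hR a b]
  have hcd : ∀ a b c d, r a b d c = - r a b c d := by
    intro a b c d
    simp only [hr]
    exact frameCurvature_skew hskew hG a b c d
  have hs : ∀ b c, ∑ a, r a b c a = Matrix.diagonal s b c := by
    intro b c
    rw [← hS, frame_ricci hP, hr]
  have hj : ∀ d a, (Pᵀ * G * jacobiMatrix R (fun i => P i 0) * P) d a = r a 0 0 d := by
    intro d a
    rw [frame_jacobi, hr]
  have e00 := hs 0 0
  have e11 := hs 1 1
  have e22 := hs 2 2
  have e12 := hs 1 2
  have e21 := hs 2 1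
  simp [Fin.sum_univ_three] at e00 e11 e22 e12 e21
  have a0 : ∀ a c d, r a a c d = 0 := fun a c d => by linarith [hab a a c d]
  have c0 : ∀ a b c, r a b c c = 0 := fun a b c => by linarith [hcd a b c c]
  have f : ∀ a b c d, r b a d c = r a b c d := fun a b c d => by rw [hab, hcd, neg_neg]
  have h12 := f 1 0 0 2
  have h21 := f 2 0 0 1
  have h11 := f 1 0 0 1
  have h22 := f 2 0 0 2
  have h33 := f 1 2 2 1
  simp only [a0, c0, zero_add, add_zero] at e00 e11 e22 e12 e21
  ext d a
  rw [hj]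
  -- The diagonal Ricci entries are sums of pairs of the three sectional curvatures, a system that
  -- can be solved for each of them. The mixed entries of the Jacobi operator are the single terms
  -- surviving in the Ricci entries `1 2` and `2 1`.
  fin_cases d <;> fin_cases a <;> simp [a0, c0] <;> linarith

/-! ### Normal form of a symmetric form of rank one. -/

section RankOne

open scoped MatrixOrder in
theorem exists_transpose_mul_self_of_posDef {G : Matrix (Fin n) (Fin n) ℝ} (hG : G.PosDef) :
    ∃ B : Matrix (Fin n) (Fin n) ℝ, G = Bᵀ * B := by
  obtain ⟨B, hB⟩ := CStarAlgebra.nonneg_iff_eq_star_mul_self.mp hG.posSemidef.nonneg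
  exact ⟨B, hB⟩

/-- Simultaneous diagonalization of a positive definite form and a symmetric form. -/
theorem exists_frame_diagonal {G S : Matrix (Fin n) (Fin n) ℝ} (hG : G.PosDef) (hS : Sᵀ = S) :
    ∃ (P : Matrix (Fin n) (Fin n) ℝ) (s : Fin n → ℝ),
      Pᵀ * G * P = 1 ∧ Pᵀ * S * P = Matrix.diagonal s := by
  obtain ⟨B, rfl⟩ := exists_transpose_mul_self_of_posDef hG
  have hB : IsUnit B.det := by
    have := hG.det_pos
    rw [Matrix.det_mul, Matrix.det_transpose] at this
    exact (left_ne_zero_of_mul this.ne').isUnit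
  have hC : ((B⁻¹)ᵀ * S * B⁻¹).IsHermitian := by
    change ((B⁻¹)ᵀ * S * B⁻¹)ᵀ = _
    rw [transpose_mul, transpose_mul, transpose_transpose, hS, Matrix.mul_assoc]
  have hspec := hC.conjStarAlgAut_star_eigenvectorUnitary
  rw [Unitary.conjStarAlgAut_apply] at hspec
  obtain ⟨O, hO⟩ : ∃ O : Matrix (Fin n) (Fin n) ℝ, O = hC.eigenvectorUnitary := ⟨_, rfl⟩
  have hO1 : Oᵀ * O = 1 := by
    rw [hO]
    exact Unitary.coe_star_mul_self hC.eigenvectorUnitary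
  refine ⟨B⁻¹ * O, hC.eigenvalues, ?_, ?_⟩
  · calc (B⁻¹ * O)ᵀ * (Bᵀ * B) * (B⁻¹ * O) = Oᵀ * ((B * B⁻¹)ᵀ * (B * B⁻¹)) * O := by
          simp only [transpose_mul, Matrix.mul_assoc]
      _ = 1 := by rw [Matrix.mul_nonsing_inv _ hB]; simp [hO1]
  · calc (B⁻¹ * O)ᵀ * S * (B⁻¹ * O) = Oᵀ * ((B⁻¹)ᵀ * S * B⁻¹) * O := by
          simp only [transpose_mul, Matrix.mul_assoc]
      _ = _ := by
          rw [hO]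
          simp only [star_star, Unitary.coe_star] at hspec
          exact hspec

/-- Invertible factors preserve the rank, so exactly one diagonal entry in a diagonalizing frame is
non-zero; a transposition of the frame moves it to index `0`. -/
theorem exists_frame_of_rank_eq_one {G S : Matrix (Fin (n + 1)) (Fin (n + 1)) ℝ} (hG : G.PosDef)
    (hS : Sᵀ = S) (hr : (G⁻¹ * S).rank = 1) :
    ∃ (P : Matrix (Fin (n + 1)) (Fin (n + 1)) ℝ) (μ : ℝ), μ ≠ 0 ∧
      Pᵀ * G * P = 1 ∧ Pᵀ * S * P = Matrix.diagonal (Pi.single 0 μ) := by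
  obtain ⟨P, s, hP, hs⟩ := exists_frame_diagonal hG hS
  have hdet : (Pᵀ).det * G.det * P.det = 1 := by
    rw [← Matrix.det_mul, ← Matrix.det_mul, hP, Matrix.det_one]
  have hPu : IsUnit P.det := (right_ne_zero_of_mul (hdet ▸ one_ne_zero)).isUnit
  have hPu' : IsUnit (Pᵀ).det := by rwa [Matrix.det_transpose]
  have hGu : IsUnit (G⁻¹).det := by
    rw [Matrix.det_nonsing_inv, Ring.inverse_eq_inv']
    exact (inv_ne_zero hG.det_pos.ne').isUnit
  rw [Matrix.rank_mul_eq_right_of_isUnit_det _ _ hGu] at hr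
  have hrd : (Matrix.diagonal s).rank = 1 := by
    rw [← hs, Matrix.rank_mul_eq_left_of_isUnit_det _ _ hPu,
      Matrix.rank_mul_eq_right_of_isUnit_det _ _ hPu', hr]
  rw [Matrix.rank_diagonal, Fintype.card_eq_one_iff] at hrd
  obtain ⟨⟨i₀, hi₀⟩, huniq⟩ := hrd
  have hzero : ∀ i, i ≠ i₀ → s i = 0 := by
    intro i hi
    by_contra h
    exact hi (congrArg Subtype.val (huniq ⟨i, h⟩))
  refine ⟨P.submatrix id (Equiv.swap 0 i₀), s i₀, hi₀, ?_, ?_⟩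
  · have : (P.submatrix id (Equiv.swap 0 i₀))ᵀ * G * P.submatrix id (Equiv.swap 0 i₀)
        = (Pᵀ * G * P).submatrix (Equiv.swap 0 i₀) (Equiv.swap 0 i₀) := by
      ext a b
      simp [Matrix.mul_apply]
    rw [this, hP, Matrix.submatrix_one_equiv]
  · have : (P.submatrix id (Equiv.swap 0 i₀))ᵀ * S * P.submatrix id (Equiv.swap 0 i₀)
        = (Pᵀ * S * P).submatrix (Equiv.swap 0 i₀) (Equiv.swap 0 i₀) := by
      ext a b
      simp [Matrix.mul_apply]
    rw [this, hs, Matrix.submatrix_diagonal_equiv]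
    congr 1
    ext a
    by_cases ha : a = 0
    · subst ha
      simp
    · rw [Pi.single_eq_of_ne ha]
      refine hzero _ fun h => ha ?_
      have := (Equiv.swap 0 i₀).injective (h.trans (Equiv.swap_apply_left 0 i₀).symm)
      exact this

/-- A symmetric form whose operator has rank one is `μ` times the square of a covector. -/
theorem exists_smul_vecMulVec_of_rank_eq_one {G S : Matrix (Fin (n + 1)) (Fin (n + 1)) ℝ}
    (hG : G.PosDef) (hS : Sᵀ = S) (hr : (G⁻¹ * S).rank = 1) :
    ∃ (μ : ℝ) (w : Fin (n + 1) → ℝ), S = μ • vecMulVec w w := by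
  obtain ⟨P, μ, -, hP, hs⟩ := exists_frame_of_rank_eq_one hG hS hr
  refine ⟨μ, fun i => (Pᵀ * G) 0 i, ?_⟩
  have hGt : Gᵀ = G := hG.isHermitian
  have h1 : P * (Pᵀ * G) = 1 := frame_mul_cancel hP
  have h2 : (G * P) * Pᵀ = 1 := by
    have := congrArg Matrix.transpose h1
    simpa [transpose_mul, hGt] using this
  have h3 : S = (Pᵀ * G)ᵀ * Matrix.diagonal (Pi.single 0 μ) * (Pᵀ * G) := by
    rw [← hs, transpose_mul, transpose_transpose, hGt]
    calc S = (G * P * Pᵀ) * S * (P * (Pᵀ * G)) := by rw [h1, h2]; simp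
      _ = _ := by simp only [Matrix.mul_assoc]
  ext a b
  rw [h3, Matrix.mul_apply, Finset.sum_eq_single 0]
  · rw [Matrix.mul_diagonal, Matrix.transpose_apply, Pi.single_eq_same, Matrix.smul_apply,
      vecMulVec_apply, smul_eq_mul]
    ring
  · intro c _ hc
    simp [hc]
  · simp

end RankOne

/-! ### Symmetry of the Ricci form. -/

section LeviCivita

variable {V : Set (Model n)} {G : Model n → Matrix (Fin n) (Fin n) ℝ}
  {Γ : Fin n → Model n → Matrix (Fin n) (Fin n) ℝ} {y : Model n}

theorem IsLeviCivitaOn.trace_curvature (h : IsLeviCivitaOn V G Γ) (hy : y ∈ V) (i j : Fin n) :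
    (curvature Γ i j y).trace = 0 := by
  have hu := h.isUnit_det hy
  have hs := h.curvature_skew hy i j
  have h1 : (G y)⁻¹ * ((curvature Γ i j y)ᵀ * G y + G y * curvature Γ i j y) = 0 := by
    rw [hs, mul_zero]
  have h2 := congrArg Matrix.trace h1
  rw [mul_add, Matrix.nonsing_inv_mul_cancel_left _ _ hu, Matrix.trace_add, Matrix.trace_mul_comm,
    Matrix.mul_nonsing_inv_cancel_right _ _ hu, Matrix.trace_transpose, Matrix.trace_zero] at h2
  linarith

/-- Contract the first Bianchi identity; the middle term is the trace of a skew-adjoint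
endomorphism. -/
theorem IsLeviCivitaOn.ricci_symm (h : IsLeviCivitaOn V G Γ) (hy : y ∈ V) :
    (ricci Γ y)ᵀ = ricci Γ y := by
  ext j k
  have hB : ∑ i, (curvature Γ i k y i j + curvature Γ k j y i i + curvature Γ j i y i k) = 0 :=
    Finset.sum_eq_zero fun i _ => h.bianchi_first hy i i k j
  have ht : ∑ i, curvature Γ k j y i i = 0 := h.trace_curvature hy k j
  have hsw : ∑ i, curvature Γ j i y i k = - ∑ i, curvature Γ i j y i k := by
    rw [← Finset.sum_neg_distrib]
    exact Finset.sum_congr rfl fun i _ => by rw [curvature_swap i j]; rfl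
  rw [Finset.sum_add_distrib, Finset.sum_add_distrib, ht, hsw] at hB
  simp only [Matrix.transpose_apply, ricci, Matrix.of_apply]
  linarith

end LeviCivita

/-! ### Covariant derivatives of forms, and the Riccati equation along a curve in coordinates. -/

/-- The value `(∇ₓ S)(a, b)` of the covariant derivative of a bilinear form. -/
def nablaForm (Γ : Fin n → Model n → Matrix (Fin n) (Fin n) ℝ)
    (S : Model n → Matrix (Fin n) (Fin n) ℝ) (y : Model n) (x a b : Fin n → ℝ) : ℝ :=
  ∑ m, x m * (a ⬝ᵥ covDerivForm Γ m S y *ᵥ b)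

/-- The connection matrix `∑ᵢ vⁱ Γᵢ` in the direction `v`. -/
def connMatrix (Γ : Fin n → Model n → Matrix (Fin n) (Fin n) ℝ) (y : Model n) (v : Fin n → ℝ) :
    Matrix (Fin n) (Fin n) ℝ :=
  ∑ i, v i • Γ i y

/-- Coordinate expression of a solution of the Riccati equation, subject to the algebraic
constraint, along a germ of geodesic with initial position `y` and initial velocity `v`. -/
structure IsConstrainedRiccati (G : Model n → Matrix (Fin n) (Fin n) ℝ)
    (Γ : Fin n → Model n → Matrix (Fin n) (Fin n) ℝ) (y : Model n) (v : Fin n → ℝ)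
    (c : ℝ → Model n) (w : ℝ → Fin n → ℝ) (U : ℝ → Matrix (Fin n) (Fin n) ℝ) : Prop where
  position : c 0 = y
  velocity : w 0 = v
  hasDerivAt_position : ∀ᶠ t in 𝓝 0, ∀ k, HasDerivAt (fun s => c s k) (w t k) t
  hasDerivAt_velocity : ∀ k, HasDerivAt (fun s => w s k) (- (connMatrix Γ y v *ᵥ v) k) 0
  differentiableAt : ∀ᶠ t in 𝓝 0, ∀ i j, DifferentiableAt ℝ (fun s => U s i j) t
  riccati : ∀ᶠ t in 𝓝 0, (Matrix.of fun i j => deriv (fun s => U s i j) t)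
    + (connMatrix Γ (c t) (w t) * U t - U t * connMatrix Γ (c t) (w t)) + U t * U t
    + jacobiMatrix (fun i j => curvature Γ i j (c t)) (w t) = 0
  symm : ∀ᶠ t in 𝓝 0, (U t)ᵀ * G (c t) = G (c t) * U t
  trace_eq_zero : ∀ᶠ t in 𝓝 0, (U t).trace = 0
  kernel : ∀ᶠ t in 𝓝 0, U t *ᵥ w t = 0

theorem trace_jacobiMatrix_curvature (Γ : Fin n → Model n → Matrix (Fin n) (Fin n) ℝ)
    (y : Model n) (v : Fin n → ℝ) :
    (jacobiMatrix (fun i j => curvature Γ i j y) v).trace = v ⬝ᵥ ricci Γ y *ᵥ v := by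
  simp only [Matrix.trace, Matrix.diag_apply, jacobiMatrix, Matrix.of_apply, dotProduct, mulVec,
    ricci, Finset.sum_mul, Finset.mul_sum]
  rw [Finset.sum_comm]
  refine Finset.sum_congr rfl fun j _ => ?_
  rw [Finset.sum_comm]
  exact Finset.sum_congr rfl fun k _ => Finset.sum_congr rfl fun i _ => by ring

section Calculus

variable {V : Set (Model n)} {y : Model n}

theorem fderiv_eq_sum_partialDeriv (f : Model n → ℝ) (y : Model n) (v : Model n) :
    fderiv ℝ f y v = ∑ m, v m * partialDeriv m f y := by
  conv_lhs => rw [← (EuclideanSpace.basisFun (Fin n) ℝ).sum_repr v]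
  simp [map_sum, partialDeriv]

theorem hasDerivAt_curve {c : ℝ → Model n} {v : Fin n → ℝ} {t : ℝ}
    (hc : ∀ k, HasDerivAt (fun s => c s k) (v k) t) : HasDerivAt c (WithLp.toLp 2 v) t := by
  rw [hasDerivAt_iff_hasFDerivAt, ← hasFDerivWithinAt_univ, hasFDerivWithinAt_euclidean]
  exact fun k => (hc k).hasFDerivAt.hasFDerivWithinAt.congr_fderiv (by ext; simp)

theorem hasDerivAt_comp_curve (hV : IsOpen V) (hy : y ∈ V) {f : Model n → ℝ}
    (hf : ContDiffOn ℝ ∞ f V) {c : ℝ → Model n} {v : Fin n → ℝ} {t : ℝ} (hc0 : c t = y)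
    (hc : ∀ k, HasDerivAt (fun s => c s k) (v k) t) :
    HasDerivAt (fun s => f (c s)) (∑ m, v m * partialDeriv m f y) t := by
  have hfd : HasFDerivAt f (fderiv ℝ f y) (c t) := by
    rw [hc0]
    exact (differentiableAt_of_contDiffOn hV hy hf).hasFDerivAt
  have := hfd.comp_hasDerivAt t (hasDerivAt_curve hc)
  rw [fderiv_eq_sum_partialDeriv] at this
  exact this

theorem dotProduct_mulVec_eq_sum (a b : Fin n → ℝ) (A : Matrix (Fin n) (Fin n) ℝ) :
    a ⬝ᵥ A *ᵥ b = ∑ i, ∑ j, a i * A i j * b j := by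
  simp only [dotProduct, mulVec, Finset.mul_sum, mul_assoc]

theorem contDiffOn_form {S : Model n → Matrix (Fin n) (Fin n) ℝ} (hS : SmoothMatrixOn S V)
    (a b : Fin n → ℝ) : ContDiffOn ℝ ∞ (fun z => a ⬝ᵥ S z *ᵥ b) V := by
  simp only [dotProduct_mulVec_eq_sum]
  exact ContDiffOn.sum fun i _ => ContDiffOn.sum fun j _ =>
    (contDiffOn_const.mul (hS i j)).mul contDiffOn_const

theorem partialDeriv_form (hV : IsOpen V) (hy : y ∈ V) {S : Model n → Matrix (Fin n) (Fin n) ℝ}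
    (hS : SmoothMatrixOn S V) (a b : Fin n → ℝ) (m : Fin n) :
    partialDeriv m (fun z => a ⬝ᵥ S z *ᵥ b) y = a ⬝ᵥ matrixDeriv m S y *ᵥ b := by
  simp only [dotProduct_mulVec_eq_sum, partialDeriv, matrixDeriv_apply]
  have hd := fun i j => hS.differentiableAt hV hy i j
  rw [fderiv_fun_sum fun i _ => DifferentiableAt.fun_sum fun j _ =>
    ((hd i j).const_mul _).mul_const _, _root_.sum_apply]
  refine Finset.sum_congr rfl fun i _ => ?_
  rw [fderiv_fun_sum fun j _ => ((hd i j).const_mul _).mul_const _, _root_.sum_apply]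
  refine Finset.sum_congr rfl fun j _ => ?_
  rw [fderiv_mul_const ((hd i j).const_mul _), fderiv_const_mul (hd i j)]
  simp
  ring

theorem hasDerivAt_form_curve (hV : IsOpen V) (hy : y ∈ V)
    {S : Model n → Matrix (Fin n) (Fin n) ℝ} (hS : SmoothMatrixOn S V) {c : ℝ → Model n}
    {a b : ℝ → Fin n → ℝ} {v a' b' : Fin n → ℝ} {t : ℝ} (hc0 : c t = y)
    (hc : ∀ k, HasDerivAt (fun s => c s k) (v k) t)
    (ha : ∀ k, HasDerivAt (fun s => a s k) (a' k) t)
    (hb : ∀ k, HasDerivAt (fun s => b s k) (b' k) t) :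
    HasDerivAt (fun s => a s ⬝ᵥ S (c s) *ᵥ b s)
      (a' ⬝ᵥ S y *ᵥ b t + ∑ m, v m * (a t ⬝ᵥ matrixDeriv m S y *ᵥ b t) + a t ⬝ᵥ S y *ᵥ b') t := by
  have hSc : ∀ i j, HasDerivAt (fun s => S (c s) i j) (∑ m, v m * matrixDeriv m S y i j) t :=
    fun i j => hasDerivAt_comp_curve hV hy (hS i j) hc0 hc
  have hsum := HasDerivAt.fun_sum (u := Finset.univ) fun i _ =>
    HasDerivAt.fun_sum (u := Finset.univ) fun j _ => ((ha i).fun_mul (hSc i j)).fun_mul (hb j)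
  have hval : (∑ i, ∑ j, ((a' i * S (c t) i j + a t i * ∑ m, v m * matrixDeriv m S y i j) * b t j
        + a t i * S (c t) i j * b' j))
      = a' ⬝ᵥ S y *ᵥ b t + ∑ m, v m * (a t ⬝ᵥ matrixDeriv m S y *ᵥ b t)
        + a t ⬝ᵥ S y *ᵥ b' := by
    have h2 : ∑ m, v m * (a t ⬝ᵥ matrixDeriv m S y *ᵥ b t)
        = ∑ i, ∑ j, a t i * (∑ m, v m * matrixDeriv m S y i j) * b t j := by
      simp only [dotProduct_mulVec_eq_sum, Finset.mul_sum, Finset.sum_mul]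
      rw [Finset.sum_comm]
      refine Finset.sum_congr rfl fun i _ => ?_
      rw [Finset.sum_comm]
      exact Finset.sum_congr rfl fun j _ => Finset.sum_congr rfl fun m _ => by ring
    rw [h2]
    simp only [dotProduct_mulVec_eq_sum, ← Finset.sum_add_distrib, hc0]
    exact Finset.sum_congr rfl fun i _ => Finset.sum_congr rfl fun j _ => by ring
  rw [← hval]
  simp only [dotProduct_mulVec_eq_sum]
  exact hsum

/-- Matches `hasDerivAt_form_curve`: for a geodesic velocity, `w' = -Γ(v) v` supplies precisely the
connection terms, so ordinary derivatives along the curve become covariant ones. -/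
theorem nablaForm_eq (Γ : Fin n → Model n → Matrix (Fin n) (Fin n) ℝ)
    (S : Model n → Matrix (Fin n) (Fin n) ℝ) (y : Model n) (x a b : Fin n → ℝ) :
    nablaForm Γ S y x a b = ∑ m, x m * (a ⬝ᵥ matrixDeriv m S y *ᵥ b)
      - (connMatrix Γ y x *ᵥ a) ⬝ᵥ S y *ᵥ b - a ⬝ᵥ S y *ᵥ (connMatrix Γ y x *ᵥ b) := by
  have h1 : (connMatrix Γ y x *ᵥ a) ⬝ᵥ S y *ᵥ b
      = ∑ m, x m * (a ⬝ᵥ ((Γ m y)ᵀ * S y) *ᵥ b) := by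
    simp only [connMatrix, Matrix.sum_mulVec, sum_dotProduct, smul_mulVec, smul_dotProduct,
      smul_eq_mul, ← mulVec_mulVec]
    refine Finset.sum_congr rfl fun m _ => ?_
    rw [dotProduct_mulVec a, vecMul_transpose]
  have h2 : a ⬝ᵥ S y *ᵥ (connMatrix Γ y x *ᵥ b) = ∑ m, x m * (a ⬝ᵥ (S y * Γ m y) *ᵥ b) := by
    simp only [connMatrix, Matrix.sum_mulVec, smul_mulVec, mulVec_sum, dotProduct_sum, mulVec_smul,
      dotProduct_smul, smul_eq_mul, ← mulVec_mulVec]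
  rw [h1, h2, ← Finset.sum_sub_distrib, ← Finset.sum_sub_distrib]
  refine Finset.sum_congr rfl fun m _ => ?_
  rw [covDerivForm, sub_mulVec, sub_mulVec, dotProduct_sub, dotProduct_sub]
  ring

end Calculus

/-! ### Pointwise consequences of the trace of the Riccati equation. -/

namespace IsConstrainedRiccati

variable {V : Set (Model n)} {G : Model n → Matrix (Fin n) (Fin n) ℝ}
  {Γ : Fin n → Model n → Matrix (Fin n) (Fin n) ℝ} {y : Model n} {v : Fin n → ℝ}
  {c : ℝ → Model n} {w : ℝ → Fin n → ℝ} {U : ℝ → Matrix (Fin n) (Fin n) ℝ}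

/-- `tr u` vanishes on a whole neighbourhood, hence so does `tr u'`; the connection enters through a
commutator, and the trace of the Jacobi operator is the Ricci form. -/
theorem trace_sq (h : IsConstrainedRiccati G Γ y v c w U) :
    ∀ᶠ t in 𝓝 0, (U t * U t).trace = - (w t ⬝ᵥ ricci Γ (c t) *ᵥ w t) := by
  filter_upwards [h.riccati, h.differentiableAt, h.trace_eq_zero.eventually_nhds]
    with t hric hdiff htr
  have h1 : (Matrix.of fun i j => deriv (fun s => U s i j) t).trace = 0 := by
    have hd : HasDerivAt (fun s => ∑ i, U s i i) (∑ i, deriv (fun s => U s i i) t) t :=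
      HasDerivAt.fun_sum fun i _ => (hdiff i i).hasDerivAt
    have hz : HasDerivAt (fun s => ∑ i, U s i i) 0 t :=
      (hasDerivAt_const t (0 : ℝ)).congr_of_eventuallyEq htr
    exact hd.unique hz
  have h2 := congrArg Matrix.trace hric
  rw [trace_add, trace_add, trace_add, h1, trace_sub, trace_mul_comm (U t), sub_self,
    trace_jacobiMatrix_curvature, trace_zero] at h2
  linarith

/-- The matrix of `U'(0)` given by the Riccati equation. -/
theorem hasDerivAt_zero (h : IsConstrainedRiccati G Γ y v c w U) (i j : Fin n) :
    HasDerivAt (fun s => U s i j)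
      ((-((connMatrix Γ y v * U 0 - U 0 * connMatrix Γ y v) + U 0 * U 0
        + jacobiMatrix (fun i j => curvature Γ i j y) v)) i j) 0 := by
  have hr := h.riccati.self_of_nhds
  rw [h.position, h.velocity] at hr
  have hd := (h.differentiableAt.self_of_nhds i j).hasDerivAt
  refine hd.congr_deriv ?_
  have := congrFun (congrFun hr i) j
  simp only [Matrix.add_apply, Matrix.of_apply, Matrix.zero_apply, Matrix.neg_apply] at this ⊢
  linarith only [this]

/-- First derivative of `trace_sq` at `0`. The Riccati equation gives `tr(u u') = -tr(u³) - tr(u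
J)`, since the commutator with the connection drops out of the trace. -/
theorem nablaForm_ricci_self (h : IsConstrainedRiccati G Γ y v c w U)
    (hL : IsLeviCivitaOn V G Γ) (hy : y ∈ V)
    (h3 : (U 0 * U 0 * U 0).trace = 0)
    (hJ : (U 0 * jacobiMatrix (fun i j => curvature Γ i j y) v).trace = 0) :
    nablaForm Γ (ricci Γ) y v v v = 0 := by
  have hw : ∀ k, HasDerivAt (fun s => w s k) ((-(connMatrix Γ y v *ᵥ v)) k) 0 :=
    h.hasDerivAt_velocity
  have hc : ∀ k, HasDerivAt (fun s => c s k) (v k) 0 := by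
    have := h.hasDerivAt_position.self_of_nhds
    rwa [h.velocity] at this
  have h1 := hasDerivAt_form_curve hL.isOpen hy hL.smooth_ricci h.position hc hw hw
  obtain ⟨D, hD⟩ : ∃ D, D = -((connMatrix Γ y v * U 0 - U 0 * connMatrix Γ y v) + U 0 * U 0
        + jacobiMatrix (fun i j => curvature Γ i j y) v) := ⟨_, rfl⟩
  have hU : ∀ i j, HasDerivAt (fun s => U s i j) (D i j) 0 := fun i j => hD ▸ h.hasDerivAt_zero i j
  have h2 : HasDerivAt (fun s => (U s * U s).trace) ((D * U 0).trace + (U 0 * D).trace) 0 := by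
    simp only [Matrix.trace, Matrix.diag_apply, Matrix.mul_apply, ← Finset.sum_add_distrib]
    exact HasDerivAt.fun_sum fun i _ => HasDerivAt.fun_sum fun j _ => (hU i j).fun_mul (hU j i)
  have h4 := h2.unique (h1.fun_neg.congr_of_eventuallyEq h.trace_sq)
  have h5 : (U 0 * D).trace = 0 := by
    rw [hD, mul_neg, mul_add, mul_add, mul_sub, trace_neg, trace_add, trace_add, trace_sub, hJ,
      ← Matrix.mul_assoc, ← Matrix.mul_assoc, ← Matrix.mul_assoc, h3,
      trace_mul_comm (U 0 * connMatrix Γ y v), ← Matrix.mul_assoc]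
    simp
  rw [trace_mul_comm D, h5, h.velocity] at h4
  rw [nablaForm_eq]
  simp only [neg_dotProduct, mulVec_neg, dotProduct_neg] at h4
  linarith

/-- The second-order term of `trace_sq`. Multiplying by `ric(e, e)` makes the right side minus a
perfect square, so only first derivatives of `u` and of `ric(γ', e)` are needed. -/
theorem nablaForm_ricci_sq (h : IsConstrainedRiccati G Γ y v c w U)
    (hL : IsLeviCivitaOn V G Γ) (hy : y ∈ V) (hU0 : U 0 = 0) (hv : v ᵥ* ricci Γ y = 0)
    (e : Fin n → ℝ) (hrank : ∀ z ∈ V, ∀ a, (a ⬝ᵥ ricci Γ z *ᵥ a) * (e ⬝ᵥ ricci Γ z *ᵥ e)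
      = (a ⬝ᵥ ricci Γ z *ᵥ e) ^ 2) :
    (jacobiMatrix (fun i j => curvature Γ i j y) v
        * jacobiMatrix (fun i j => curvature Γ i j y) v).trace * (e ⬝ᵥ ricci Γ y *ᵥ e)
      = - (nablaForm Γ (ricci Γ) y v v e) ^ 2 := by
  obtain ⟨J, hJ⟩ : ∃ J, J = jacobiMatrix (fun i j => curvature Γ i j y) v := ⟨_, rfl⟩
  have hU : ∀ i j, HasDerivAt (fun s => U s i j) ((-J) i j) 0 := by
    intro i j
    have := h.hasDerivAt_zero i j
    rw [hU0] at this
    simpa [hJ] using this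
  have hw : ∀ k, HasDerivAt (fun s => w s k) ((-(connMatrix Γ y v *ᵥ v)) k) 0 :=
    h.hasDerivAt_velocity
  have hc : ∀ k, HasDerivAt (fun s => c s k) (v k) 0 := by
    have := h.hasDerivAt_position.self_of_nhds
    rwa [h.velocity] at this
  have ha := hasDerivAt_form_curve hL.isOpen hy hL.smooth_ricci h.position hc hw
    (b := fun _ => e) (b' := 0) fun k => hasDerivAt_const 0 (e k)
  -- `e` is constant in coordinates, not parallel; the discrepancy `ric(v, Γ(v) e)` vanishes because
  -- `v` lies in the kernel.
  have hval : (-(connMatrix Γ y v *ᵥ v)) ⬝ᵥ ricci Γ y *ᵥ e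
      + ∑ m, v m * (w 0 ⬝ᵥ matrixDeriv m (ricci Γ) y *ᵥ e) + w 0 ⬝ᵥ ricci Γ y *ᵥ 0
      = nablaForm Γ (ricci Γ) y v v e := by
    rw [nablaForm_eq, h.velocity, dotProduct_mulVec v (ricci Γ y) (_ *ᵥ e), hv, neg_dotProduct]
    simp
    ring
  rw [hval] at ha
  have hse := hasDerivAt_comp_curve hL.isOpen hy (contDiffOn_form hL.smooth_ricci e e) h.position hc
  have hcV : ∀ᶠ t in 𝓝 0, c t ∈ V := by
    have hcc : ContinuousAt c 0 := (hasDerivAt_curve hc).continuousAt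
    exact hcc.eventually (h.position ▸ hL.isOpen.mem_nhds hy)
  -- Both `u` and `ric(γ', e)` vanish at `0`, so after division by `t²` each factor is a difference
  -- quotient with a limit.
  have heq : ∀ᶠ t in 𝓝[≠] (0 : ℝ),
      (∑ i, ∑ j, (t⁻¹ * U t i j) * (t⁻¹ * U t j i)) * (e ⬝ᵥ ricci Γ (c t) *ᵥ e)
        = - (t⁻¹ * (w t ⬝ᵥ ricci Γ (c t) *ᵥ e)) ^ 2 := by
    filter_upwards [nhdsWithin_le_nhds h.trace_sq, nhdsWithin_le_nhds hcV] with t ht htV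
    have h1 : ∑ i, ∑ j, (t⁻¹ * U t i j) * (t⁻¹ * U t j i) = t⁻¹ ^ 2 * (U t * U t).trace := by
      simp only [Matrix.trace, Matrix.diag_apply, Matrix.mul_apply, Finset.mul_sum]
      exact Finset.sum_congr rfl fun i _ => Finset.sum_congr rfl fun j _ => by ring
    rw [h1, ht, mul_pow, ← hrank _ htV (w t)]
    ring
  have ha0 : w 0 ⬝ᵥ ricci Γ (c 0) *ᵥ e = 0 := by
    rw [h.velocity, h.position, dotProduct_mulVec, hv, zero_dotProduct]
  have tU : ∀ i j, Tendsto (fun t => t⁻¹ * U t i j) (𝓝[≠] 0) (𝓝 ((-J) i j)) := by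
    intro i j
    simpa [hU0] using hasDerivAt_iff_tendsto_slope_zero.1 (hU i j)
  have ta : Tendsto (fun t => t⁻¹ * (w t ⬝ᵥ ricci Γ (c t) *ᵥ e)) (𝓝[≠] 0)
      (𝓝 (nablaForm Γ (ricci Γ) y v v e)) := by
    have := hasDerivAt_iff_tendsto_slope_zero.1 ha
    simpa only [zero_add, ha0, sub_zero, smul_eq_mul] using this
  have te : Tendsto (fun t => e ⬝ᵥ ricci Γ (c t) *ᵥ e) (𝓝[≠] 0) (𝓝 (e ⬝ᵥ ricci Γ y *ᵥ e)) := by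
    have := hse.continuousAt.tendsto.mono_left (nhdsWithin_le_nhds (s := {0}ᶜ))
    rwa [h.position] at this
  have t1 := ((tendsto_finsetSum Finset.univ fun i _ =>
    tendsto_finsetSum Finset.univ fun j _ => (tU i j).mul (tU j i)).mul te)
  have t2 := (ta.pow 2).neg
  have := tendsto_nhds_unique (t1.congr' heq) t2
  rw [← this, ← hJ]
  congr 1
  simp [Matrix.trace, Matrix.mul_apply]

end IsConstrainedRiccati

/-- Newton's identity for the eigenvalues when their sum is zero. -/
theorem trace_cube_eq (A : Matrix (Fin 3) (Fin 3) ℝ) (hA : A.trace = 0) :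
    (A * A * A).trace = 3 * A.det := by
  have h : A 2 2 = - A 0 0 - A 1 1 := by
    simp only [Matrix.trace, Matrix.diag_apply, Fin.sum_univ_three] at hA
    linarith
  simp only [Matrix.trace, Matrix.diag_apply, Fin.sum_univ_three, Matrix.mul_apply,
    Matrix.det_fin_three, h]
  ring

/-! ### Endomorphisms in an orthonormal frame. -/

section Frame

variable {G P : Matrix (Fin n) (Fin n) ℝ}

theorem frame_entry (S : Matrix (Fin n) (Fin n) ℝ) (a b : Fin n) :
    (Pᵀ * S * P) a b = P.col a ⬝ᵥ S *ᵥ P.col b := by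
  rw [Matrix.mul_assoc, Matrix.mul_apply]
  simp [dotProduct, mulVec, Matrix.mul_apply]

theorem trace_frame (hP : Pᵀ * G * P = 1) (A : Matrix (Fin n) (Fin n) ℝ) :
    (Pᵀ * G * A * P).trace = A.trace := by
  rw [Matrix.trace_mul_comm, ← Matrix.mul_assoc, frame_mul_cancel hP, Matrix.one_mul]

theorem frame_mul (hP : Pᵀ * G * P = 1) (A B : Matrix (Fin n) (Fin n) ℝ) :
    Pᵀ * G * (A * B) * P = (Pᵀ * G * A * P) * (Pᵀ * G * B * P) := by
  calc Pᵀ * G * (A * B) * P = Pᵀ * G * A * (P * (Pᵀ * G)) * B * P := by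
        rw [frame_mul_cancel hP]
        simp only [Matrix.mul_assoc, Matrix.one_mul]
    _ = _ := by simp only [Matrix.mul_assoc]

theorem frame_symm (hG : Gᵀ = G) {U : Matrix (Fin n) (Fin n) ℝ} (hU : Uᵀ * G = G * U) :
    (Pᵀ * G * U * P)ᵀ = Pᵀ * G * U * P := by
  simp only [transpose_mul, transpose_transpose, hG, Matrix.mul_assoc]
  rw [← Matrix.mul_assoc Uᵀ, hU, Matrix.mul_assoc]

/-- In an orthonormal frame the matrix of `U` is symmetric, so `tr U²` is the sum of the squares of
its entries. -/
theorem eq_zero_of_trace_sq_eq_zero (hG : Gᵀ = G) (hP : Pᵀ * G * P = 1)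
    {U : Matrix (Fin n) (Fin n) ℝ} (hU : Uᵀ * G = G * U) (ht : (U * U).trace = 0) : U = 0 := by
  have h1 : ((Pᵀ * G * U * P)ᵀ * (Pᵀ * G * U * P)).trace = 0 := by
    rw [frame_symm hG hU, ← frame_mul hP, trace_frame hP, ht]
  have h2 : Pᵀ * G * U * P = 0 := Matrix.trace_conjTranspose_mul_self_eq_zero_iff.1 h1
  have h3 := frame_mul_cancel hP
  calc U = (P * (Pᵀ * G)) * U * (P * (Pᵀ * G)) := by rw [h3]; simp
    _ = P * (Pᵀ * G * U * P) * (Pᵀ * G) := by simp only [Matrix.mul_assoc]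
    _ = 0 := by rw [h2]; simp

theorem inv_eq_frame (hP : Pᵀ * G * P = 1) : G⁻¹ = P * Pᵀ :=
  Matrix.inv_eq_left_inv (by rw [Matrix.mul_assoc, frame_mul_cancel hP])

end Frame

/-! ### The contracted Bianchi identity in a frame, and derivatives on the kernel of `ric`. -/

section Contraction

variable {V : Set (Model n)} {G : Model n → Matrix (Fin n) (Fin n) ℝ}
  {Γ : Fin n → Model n → Matrix (Fin n) (Fin n) ℝ} {y : Model n}

theorem covDerivForm_symm (hL : IsLeviCivitaOn V G Γ) (hy : y ∈ V) (m : Fin n) :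
    (covDerivForm Γ m (ricci Γ) y)ᵀ = covDerivForm Γ m (ricci Γ) y := by
  have hd : (matrixDeriv m (ricci Γ) y)ᵀ = matrixDeriv m (ricci Γ) y := by
    rw [← matrixDeriv_transpose]
    exact matrixDeriv_congr hL.isOpen hy (fun z hz => hL.ricci_symm hz) m
  simp only [covDerivForm, transpose_sub, transpose_mul, transpose_transpose, hd,
    hL.ricci_symm hy]
  abel

theorem nablaForm_symm (hL : IsLeviCivitaOn V G Γ) (hy : y ∈ V) (x a b : Fin n → ℝ) :
    nablaForm Γ (ricci Γ) y x a b = nablaForm Γ (ricci Γ) y x b a := by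
  unfold nablaForm
  refine Finset.sum_congr rfl fun m _ => ?_
  rw [dotProduct_comm, ← vecMul_transpose, covDerivForm_symm hL hy, ← dotProduct_mulVec]

/-- The contracted second Bianchi identity in an orthonormal frame. -/
theorem nablaForm_contracted (hL : IsLeviCivitaOn V G Γ) (hy : y ∈ V)
    {P : Matrix (Fin n) (Fin n) ℝ} (hP : Pᵀ * G y * P = 1) (x : Fin n → ℝ) :
    ∑ a, nablaForm Γ (ricci Γ) y x (P.col a) (P.col a)
      = 2 * ∑ a, nablaForm Γ (ricci Γ) y (P.col a) x (P.col a) := by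
  have hinv : ∀ j k, (G y)⁻¹ j k = ∑ a, P j a * P k a := by
    intro j k
    rw [inv_eq_frame hP, Matrix.mul_apply]
    rfl
  have h1 : ∑ a, nablaForm Γ (ricci Γ) y x (P.col a) (P.col a)
      = ∑ m, x m * ∑ j, ∑ k, (G y)⁻¹ j k * covDerivForm Γ m (ricci Γ) y j k := by
    simp only [nablaForm]
    rw [Finset.sum_comm]
    refine Finset.sum_congr rfl fun m _ => ?_
    rw [← Finset.mul_sum]
    congr 1
    simp only [dotProduct_mulVec_eq_sum, hinv, Finset.sum_mul, Matrix.col_apply]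
    rw [Finset.sum_comm]
    refine Finset.sum_congr rfl fun j _ => ?_
    rw [Finset.sum_comm]
    exact Finset.sum_congr rfl fun k _ => Finset.sum_congr rfl fun a _ => by ring
  have h2 : ∑ a, nablaForm Γ (ricci Γ) y (P.col a) x (P.col a)
      = ∑ m, x m * ∑ j, ∑ k, (G y)⁻¹ j k * covDerivForm Γ j (ricci Γ) y m k := by
    simp only [nablaForm, dotProduct_mulVec_eq_sum, hinv, Finset.sum_mul, Matrix.col_apply,
      Finset.mul_sum]
    rw [Finset.sum_comm]
    conv_rhs => rw [Finset.sum_comm]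
    refine Finset.sum_congr rfl fun j _ => ?_
    rw [Finset.sum_comm]
    refine Finset.sum_congr rfl fun m _ => ?_
    rw [Finset.sum_comm]
    exact Finset.sum_congr rfl fun k _ => Finset.sum_congr rfl fun a _ => by ring
  rw [h1, h2, Finset.mul_sum]
  refine Finset.sum_congr rfl fun m _ => ?_
  rw [hL.bianchi_contracted hy m]
  ring

theorem nablaForm_add_smul (S : Model n → Matrix (Fin n) (Fin n) ℝ) (p q a : Fin n → ℝ)
    (r s : ℝ) :
    nablaForm Γ S y (r • p + s • q) (r • p + s • q) a
      = r ^ 2 * nablaForm Γ S y p p a + s ^ 2 * nablaForm Γ S y q q a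
        + r * s * (nablaForm Γ S y p q a + nablaForm Γ S y q p a) := by
  simp only [nablaForm, Finset.mul_sum, ← Finset.sum_add_distrib]
  refine Finset.sum_congr rfl fun m _ => ?_
  simp only [add_dotProduct, smul_dotProduct, Pi.add_apply, Pi.smul_apply, smul_eq_mul]
  ring

/-- Differentiate `ric(f, f) ric(e, e) = ric(f, e)²` with `f`, `e` constant. Both `ric(f, f)` and
`ric(f, e)` vanish at `y`, leaving `ric(e, e)` times the derivative of `ric(f, f)`; the connection
terms vanish since `f` is in the kernel. -/
theorem nablaForm_kernel_self (hL : IsLeviCivitaOn V G Γ) (hy : y ∈ V) {e f : Fin n → ℝ}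
    (hrank : ∀ z ∈ V, ∀ a, (a ⬝ᵥ ricci Γ z *ᵥ a) * (e ⬝ᵥ ricci Γ z *ᵥ e)
      = (a ⬝ᵥ ricci Γ z *ᵥ e) ^ 2)
    (he : e ⬝ᵥ ricci Γ y *ᵥ e ≠ 0) (hf : ricci Γ y *ᵥ f = 0) (x : Fin n → ℝ) :
    nablaForm Γ (ricci Γ) y x f f = 0 := by
  have hf' : f ᵥ* ricci Γ y = 0 := by
    rw [← mulVec_transpose, hL.ricci_symm hy, hf]
  have hd : ∀ m, f ⬝ᵥ matrixDeriv m (ricci Γ) y *ᵥ f = 0 := by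
    intro m
    have hs := fun a b => differentiableAt_of_contDiffOn hL.isOpen hy
      (contDiffOn_form hL.smooth_ricci a b)
    have heq : partialDeriv m (fun z => (f ⬝ᵥ ricci Γ z *ᵥ f) * (e ⬝ᵥ ricci Γ z *ᵥ e)) y
        = partialDeriv m (fun z => (f ⬝ᵥ ricci Γ z *ᵥ e) ^ 2) y := by
      unfold partialDeriv
      rw [Filter.EventuallyEq.fderiv_eq]
      filter_upwards [hL.isOpen.mem_nhds hy] with z hz
      exact hrank z hz f
    have hz1 : f ⬝ᵥ ricci Γ y *ᵥ f = 0 := by rw [hf, dotProduct_zero]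
    have hz2 : f ⬝ᵥ ricci Γ y *ᵥ e = 0 := by rw [dotProduct_mulVec, hf', zero_dotProduct]
    rw [partialDeriv, partialDeriv, fderiv_fun_mul (hs f f) (hs e e), fderiv_fun_pow 2 (hs f e),
      hz1, hz2] at heq
    have hp := partialDeriv_form hL.isOpen hy hL.smooth_ricci f f m
    rw [partialDeriv] at hp
    simp [hp, he] at heq
    exact heq
  rw [nablaForm_eq]
  rw [dotProduct_mulVec f (ricci Γ y), hf', zero_dotProduct, hf, dotProduct_zero]
  simp [hd]

end Contraction

/-! ### The contradiction in dimension three. -/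

section DimensionThree

variable {V : Set (Model 3)} {G : Model 3 → Matrix (Fin 3) (Fin 3) ℝ}
  {Γ : Fin 3 → Model 3 → Matrix (Fin 3) (Fin 3) ℝ} {y : Model 3}
  {P : Matrix (Fin 3) (Fin 3) ℝ} {μ : ℝ}

theorem frame_jacobi_curvature (hL : IsLeviCivitaOn V G Γ) (hy : y ∈ V) (hP : Pᵀ * G y * P = 1)
    {s : Fin 3 → ℝ} (hS : Pᵀ * ricci Γ y * P = Matrix.diagonal s) :
    Pᵀ * G y * jacobiMatrix (fun i j => curvature Γ i j y) (P.col 0) * P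
      = Matrix.diagonal ![0, (s 0 + s 1 - s 2) / 2, (s 0 - s 1 + s 2) / 2] :=
  frame_jacobi_of_ricci_diagonal (fun i j => curvature_swap i j)
    (fun i j => hL.curvature_skew hy i j) (hL.symm y hy) hP hS

/-- In this frame the Jacobi operator is `diag(0, μ/2, μ/2)` and `U 0` kills the first vector, so
`tr(U J) = (μ/2) tr U = 0`; the same kernel gives `det U = 0`, hence `tr U³ = 0`. -/
theorem nablaForm_ricci_axis (hL : IsLeviCivitaOn V G Γ) (hy : y ∈ V) (hP : Pᵀ * G y * P = 1)
    (hS : Pᵀ * ricci Γ y * P = Matrix.diagonal (Pi.single 0 μ))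
    {c : ℝ → Model 3} {w : ℝ → Fin 3 → ℝ} {U : ℝ → Matrix (Fin 3) (Fin 3) ℝ}
    (h : IsConstrainedRiccati G Γ y (P.col 0) c w U) :
    nablaForm Γ (ricci Γ) y (P.col 0) (P.col 0) (P.col 0) = 0 := by
  have hk : U 0 *ᵥ P.col 0 = 0 := by
    have := h.kernel.self_of_nhds
    rwa [h.velocity] at this
  have htr : (U 0).trace = 0 := h.trace_eq_zero.self_of_nhds
  have hne : P.col 0 ≠ 0 := by
    intro h0
    have := frame_entry (P := P) (G y) 0 0
    rw [hP, h0] at this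
    simp at this
  refine h.nablaForm_ricci_self hL hy ?_ ?_
  · rw [trace_cube_eq _ htr, Matrix.exists_mulVec_eq_zero_iff.1 ⟨_, hne, hk⟩, mul_zero]
  · have hJ := frame_jacobi_curvature hL hy hP hS
    have hcol : (Pᵀ * G y * U 0 * P) 0 0 = 0 := by
      rw [Matrix.mul_assoc (Pᵀ * G y), Matrix.mul_apply]
      refine Finset.sum_eq_zero fun i _ => ?_
      have : (U 0 * P) i 0 = (U 0 *ᵥ P.col 0) i := rfl
      rw [this, hk, Pi.zero_apply, mul_zero]
    have ht := trace_frame hP (U 0)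
    rw [htr] at ht
    rw [← trace_frame hP, frame_mul hP, hJ]
    simp only [Matrix.trace, Matrix.diag_apply, Matrix.mul_diagonal, Fin.sum_univ_three, hcol]
      at ht ⊢
    simp
    linear_combination (μ / 2) * ht

/-- The axis is now the last frame vector and the velocity the first, so the Jacobi operator is
`diag(0, -μ/2, μ/2)` and `tr J² = μ²/2`. As the velocity lies in the kernel of `ric`, `tr U² = 0` at
time `0` and `U` starts at `0`, as `nablaForm_ricci_sq` requires. -/
theorem nablaForm_ricci_perp (hL : IsLeviCivitaOn V G Γ) (hy : y ∈ V) (hP : Pᵀ * G y * P = 1)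
    (hS : Pᵀ * ricci Γ y * P = Matrix.diagonal (Pi.single 2 μ))
    (hrank : ∀ z ∈ V, ∀ a, (a ⬝ᵥ ricci Γ z *ᵥ a) * (P.col 2 ⬝ᵥ ricci Γ z *ᵥ P.col 2)
      = (a ⬝ᵥ ricci Γ z *ᵥ P.col 2) ^ 2)
    {c : ℝ → Model 3} {w : ℝ → Fin 3 → ℝ} {U : ℝ → Matrix (Fin 3) (Fin 3) ℝ}
    (h : IsConstrainedRiccati G Γ y (P.col 0) c w U) :
    nablaForm Γ (ricci Γ) y (P.col 0) (P.col 0) (P.col 2) ^ 2 = - μ ^ 3 / 2 := by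
  have hJ := frame_jacobi_curvature hL hy hP hS
  have hvec : P.col 0 ᵥ* ricci Γ y = 0 := by
    have h1 : Pᵀ * ricci Γ y = Matrix.diagonal (Pi.single 2 μ) * (Pᵀ * G y) := by
      rw [← hS, Matrix.mul_assoc _ P, frame_mul_cancel hP, Matrix.mul_one]
    have h2 : P.col 0 ᵥ* ricci Γ y = (Pᵀ * ricci Γ y) 0 := rfl
    rw [h2, h1]
    ext i
    rw [Matrix.diagonal_mul]
    simp
  have h0 : U 0 = 0 := by
    have hs := h.symm.self_of_nhds
    rw [h.position] at hs
    refine eq_zero_of_trace_sq_eq_zero (hL.symm y hy) hP hs ?_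
    rw [h.trace_sq.self_of_nhds, h.position, h.velocity, dotProduct_mulVec, hvec, zero_dotProduct,
      neg_zero]
  have hmain := h.nablaForm_ricci_sq hL hy h0 hvec (P.col 2) hrank
  have hμ : P.col 2 ⬝ᵥ ricci Γ y *ᵥ P.col 2 = μ := by
    rw [← frame_entry, hS]
    simp
  rw [hμ, ← trace_frame hP, frame_mul hP, hJ, Matrix.diagonal_mul_diagonal] at hmain
  simp [Matrix.trace, Fin.sum_univ_three] at hmain
  linear_combination hmain

/-- An orthonormal frame whose first vector is `r f₁ + s f₂` and whose last one is `f₀`. -/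
def rotatedFrame (P : Matrix (Fin 3) (Fin 3) ℝ) (r s : ℝ) : Matrix (Fin 3) (Fin 3) ℝ :=
  P * !![0, 0, 1; r, -s, 0; s, r, 0]

theorem col_zero_rotatedFrame (r s : ℝ) :
    (rotatedFrame P r s).col 0 = r • P.col 1 + s • P.col 2 := by
  ext i
  simp [rotatedFrame, Matrix.mul_apply, Fin.sum_univ_three, mul_comm]

theorem col_two_rotatedFrame (r s : ℝ) : (rotatedFrame P r s).col 2 = P.col 0 := by
  ext i
  simp [rotatedFrame, Matrix.mul_apply, Fin.sum_univ_three]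

theorem rotatedFrame_conj (A : Matrix (Fin 3) (Fin 3) ℝ) (r s : ℝ) :
    (rotatedFrame P r s)ᵀ * A * rotatedFrame P r s
      = !![0, 0, 1; r, -s, 0; s, r, 0]ᵀ * (Pᵀ * A * P) * !![0, 0, 1; r, -s, 0; s, r, 0] := by
  simp only [rotatedFrame, transpose_mul, Matrix.mul_assoc]

theorem false_of_ricci_rank_one (hL : IsLeviCivitaOn V G Γ) (hy : y ∈ V)
    (hr : ∀ z ∈ V, ((G z)⁻¹ * ricci Γ z).rank = 1)
    (hR : ∀ v, v ⬝ᵥ G y *ᵥ v = 1 → ∃ c w U, IsConstrainedRiccati G Γ y v c w U) : False := by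
  obtain ⟨P, μ, hμ, hP, hS⟩ :=
    exists_frame_of_rank_eq_one (hL.posDef y hy) (hL.ricci_symm hy) (hr y hy)
  have hrank : ∀ z ∈ V, ∀ e a, (a ⬝ᵥ ricci Γ z *ᵥ a) * (e ⬝ᵥ ricci Γ z *ᵥ e)
      = (a ⬝ᵥ ricci Γ z *ᵥ e) ^ 2 := by
    intro z hz e a
    obtain ⟨ν, w, hw⟩ :=
      exists_smul_vecMulVec_of_rank_eq_one (hL.posDef z hz) (hL.ricci_symm hz) (hr z hz)
    have hform : ∀ a b, a ⬝ᵥ ricci Γ z *ᵥ b = ν * ((a ⬝ᵥ w) * (w ⬝ᵥ b)) := by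
      intro a b
      rw [hw, smul_mulVec, dotProduct_smul, vecMulVec_mulVec, dotProduct_smul]
      simp
    rw [hform, hform, hform, dotProduct_comm w a, dotProduct_comm w e]
    ring
  have hunit : ∀ (Q : Matrix (Fin 3) (Fin 3) ℝ), Qᵀ * G y * Q = 1 →
      Q.col 0 ⬝ᵥ G y *ᵥ Q.col 0 = 1 := by
    intro Q hQ
    rw [← frame_entry, hQ, Matrix.one_apply_eq]
  have hax : nablaForm Γ (ricci Γ) y (P.col 0) (P.col 0) (P.col 0) = 0 := by
    obtain ⟨c, w, U, h⟩ := hR _ (hunit P hP)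
    exact nablaForm_ricci_axis hL hy hP hS h
  have hperp : ∀ r s : ℝ, r ^ 2 + s ^ 2 = 1 →
      nablaForm Γ (ricci Γ) y (r • P.col 1 + s • P.col 2) (r • P.col 1 + s • P.col 2) (P.col 0) ^ 2
        = - μ ^ 3 / 2 := by
    intro r s hrs
    have hQ : (rotatedFrame P r s)ᵀ * G y * rotatedFrame P r s = 1 := by
      rw [rotatedFrame_conj, hP]
      ext i j
      fin_cases i <;> fin_cases j <;> simp [Matrix.mul_apply, Fin.sum_univ_three] <;>
        first | ring1 | linear_combination hrs
    have hQS : (rotatedFrame P r s)ᵀ * ricci Γ y * rotatedFrame P r s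
        = Matrix.diagonal (Pi.single 2 μ) := by
      rw [rotatedFrame_conj, hS]
      ext i j
      fin_cases i <;> fin_cases j <;> simp [Matrix.mul_apply, Fin.sum_univ_three]
    obtain ⟨c, w, U, h⟩ := hR _ (hunit _ hQ)
    have := nablaForm_ricci_perp hL hy hQ hQS (fun z hz a => hrank z hz _ a) h
    rwa [col_zero_rotatedFrame, col_two_rotatedFrame] at this
  have hker : ∀ a, a ≠ 0 → ricci Γ y *ᵥ P.col a = 0 := by
    intro a ha
    have h1 : ricci Γ y * P = (G y * P) * Matrix.diagonal (Pi.single 0 μ) := by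
      have h2 : (G y * P) * Pᵀ = 1 := by
        have := congrArg Matrix.transpose (frame_mul_cancel hP)
        simpa only [transpose_mul, transpose_transpose, hL.symm y hy, transpose_one] using this
      rw [← hS, ← Matrix.mul_assoc, ← Matrix.mul_assoc, h2, Matrix.one_mul]
    ext i
    have h3 : (ricci Γ y *ᵥ P.col a) i = (ricci Γ y * P) i a := rfl
    rw [h3, h1, Matrix.mul_diagonal]
    simp [ha]
  have he : P.col 0 ⬝ᵥ ricci Γ y *ᵥ P.col 0 ≠ 0 := by
    rw [← frame_entry, hS]
    simpa using hμ
  have hself : ∀ a, a ≠ 0 → nablaForm Γ (ricci Γ) y (P.col 0) (P.col a) (P.col a) = 0 :=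
    fun a ha => nablaForm_kernel_self hL hy (fun z hz a => hrank z hz _ a) he (hker a ha) _
  -- The whole left side and the axis term on the right vanish, so `v ↦ (∇_v ric)(v, f₀)` is
  -- trace-free on `f₀^⊥`.
  have hB := nablaForm_contracted hL hy hP (P.col 0)
  rw [Fin.sum_univ_three, Fin.sum_univ_three, hax, hself 1 (by decide), hself 2 (by decide),
    nablaForm_symm hL hy (P.col 1), nablaForm_symm hL hy (P.col 2)] at hB
  -- With `r² + s² = 1` the form is `A (r² - s²) + B r s`. Three rational points of the circle
  -- suffice: the last two differ in the sign of `s`, which isolates `A B`, and `(r² - s²)² ≠ 1`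
  -- there then forces `A = 0`.
  have h1 := hperp 1 0 (by norm_num)
  have h2 := hperp (3 / 5) (4 / 5) (by norm_num)
  have h3 := hperp (3 / 5) (-4 / 5) (by norm_num)
  rw [nablaForm_add_smul] at h1 h2 h3
  obtain ⟨A, hA⟩ : ∃ A, A = nablaForm Γ (ricci Γ) y (P.col 1) (P.col 1) (P.col 0) := ⟨_, rfl⟩
  obtain ⟨B, hB'⟩ : ∃ B, B = nablaForm Γ (ricci Γ) y (P.col 1) (P.col 2) (P.col 0)
    + nablaForm Γ (ricci Γ) y (P.col 2) (P.col 1) (P.col 0) := ⟨_, rfl⟩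
  have hC : nablaForm Γ (ricci Γ) y (P.col 2) (P.col 2) (P.col 0) = -A := by linarith
  rw [← hA, ← hB', hC] at h1 h2 h3
  have hA2 : A ^ 2 = - μ ^ 3 / 2 := by linear_combination h1
  have hA0 : A ≠ 0 := by
    intro h0
    rw [h0] at hA2
    have : μ ^ 3 = 0 := by linear_combination 2 * hA2
    exact hμ (pow_eq_zero_iff (by norm_num) |>.1 this)
  have hAB : A * B = 0 := by linear_combination (-625 / 336) * (h2 - h3)
  have hB0 : B = 0 := (mul_eq_zero.1 hAB).resolve_left hA0
  rw [hB0] at h2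
  have : A ^ 2 = 0 := by linear_combination (625 / 576) * (hA2 - h2)
  exact hA0 (pow_eq_zero_iff (by norm_num) |>.1 this)

end DimensionThree

/-! ### Translation of metric, connection and curvature into a smooth chart. -/

variable {M : Type*} [TopologicalSpace M] [ChartedSpace (Model n) M]

section Chart

variable {φ : OpenPartialHomeomorph M (Model n)} {x : M}

theorem IsSmoothChart.mdifferentiable (hφ : IsSmoothChart φ) :
    φ.MDifferentiable (𝓡 n) (𝓡 n) :=
  ⟨(contMDiffOn_of_mem_maximalAtlas hφ).mdifferentiableOn (by simp),
    (contMDiffOn_symm_of_mem_maximalAtlas hφ).mdifferentiableOn (by simp)⟩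

/-- The differential of a smooth chart, as a linear isomorphism onto the model space. -/
def IsSmoothChart.coords (hφ : IsSmoothChart φ) (hx : x ∈ φ.source) :
    TangentSpace (𝓡 n) x ≃L[ℝ] Model n :=
  hφ.mdifferentiable.mfderiv hx

theorem IsSmoothChart.coordVector_eq (hφ : IsSmoothChart φ) (hx : x ∈ φ.source) (i : Fin n) :
    coordVector φ x i = (hφ.coords hx).symm (EuclideanSpace.single i (1 : ℝ)) := by
  have h : mfderiv (𝓡 n) (𝓡 n) φ x
      = ((hφ.mdifferentiable.mfderiv hx : TangentSpace (𝓡 n) x ≃L[ℝ] TangentSpace (𝓡 n) (φ x)) :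
        TangentSpace (𝓡 n) x →L[ℝ] TangentSpace (𝓡 n) (φ x)) := rfl
  rw [coordVector, h, ContinuousLinearMap.inverse_equiv]
  rfl

theorem IsSmoothChart.coordVector_eq_mfderiv_symm (hφ : IsSmoothChart φ) (hx : x ∈ φ.source)
    (i : Fin n) : coordVector φ x i
      = mfderiv (𝓡 n) (𝓡 n) φ.symm (φ x) (EuclideanSpace.single i (1 : ℝ) : Model n) := by
  rw [hφ.coordVector_eq hx]
  rfl

theorem IsSmoothChart.component_eq (hφ : IsSmoothChart φ) (hx : x ∈ φ.source)
    (a : TangentSpace (𝓡 n) x) (i : Fin n) : component φ x a i = hφ.coords hx a i := rfl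

theorem IsSmoothChart.eq_sum_coordVector (hφ : IsSmoothChart φ) (hx : x ∈ φ.source)
    (a : TangentSpace (𝓡 n) x) : a = ∑ i, component φ x a i • coordVector φ x i := by
  apply (hφ.coords hx).injective
  rw [map_sum]
  simp only [map_smul, hφ.coordVector_eq hx, ContinuousLinearEquiv.apply_symm_apply,
    hφ.component_eq hx]
  conv_lhs => rw [← (EuclideanSpace.basisFun (Fin n) ℝ).sum_repr (hφ.coords hx a)]
  simp

theorem IsSmoothChart.endoMatrix_mulVec (hφ : IsSmoothChart φ) {γ : ℝ → M}
    (u : ∀ t : ℝ, TangentSpace (𝓡 n) (γ t) →ₗ[ℝ] TangentSpace (𝓡 n) (γ t)) {t : ℝ}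
    (ht : γ t ∈ φ.source) (a : TangentSpace (𝓡 n) (γ t)) :
    endoMatrix φ γ u t *ᵥ component φ (γ t) a = component φ (γ t) (u t a) := by
  ext i
  conv_rhs => rw [hφ.eq_sum_coordVector ht a]
  rw [map_sum]
  simp only [map_smul, hφ.component_eq ht, map_sum, mulVec, dotProduct, endoMatrix,
    Matrix.of_apply]
  simp [mul_comm]

theorem IsSmoothChart.component_coordVector (hφ : IsSmoothChart φ) (hx : x ∈ φ.source)
    (i : Fin n) : component φ x (coordVector φ x i) = Pi.single i 1 := by
  ext k
  rw [hφ.component_eq hx, hφ.coordVector_eq hx, ContinuousLinearEquiv.apply_symm_apply]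
  simp [Pi.single_apply]

theorem IsSmoothChart.trace_endoMatrix (hφ : IsSmoothChart φ) {γ : ℝ → M}
    (u : ∀ t : ℝ, TangentSpace (𝓡 n) (γ t) →ₗ[ℝ] TangentSpace (𝓡 n) (γ t)) {t : ℝ}
    (ht : γ t ∈ φ.source) :
    (endoMatrix φ γ u t).trace = LinearMap.trace ℝ (TangentSpace (𝓡 n) (γ t)) (u t) := by
  obtain ⟨b, hb⟩ : ∃ b : Module.Basis (Fin n) ℝ (TangentSpace (𝓡 n) (γ t)), b =
    (EuclideanSpace.basisFun (Fin n) ℝ).toBasis.map (hφ.coords ht).symm.toLinearEquiv := ⟨_, rfl⟩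
  rw [LinearMap.trace_eq_matrix_trace ℝ b]
  congr 1
  ext i j
  rw [LinearMap.toMatrix_apply, endoMatrix, Matrix.of_apply, hφ.component_eq ht,
    hφ.coordVector_eq ht, hb]
  simp

variable [IsManifold (𝓡 n) ∞ M]

theorem IsSmoothChart.inner_eq (hφ : IsSmoothChart φ) (g : Metric n M) (hx : x ∈ φ.source)
    (a b : TangentSpace (𝓡 n) x) :
    g.inner x a b = component φ x a ⬝ᵥ metricCoeff g φ (φ x) *ᵥ component φ x b := by
  -- `metricCoeff` is evaluated at `φ.symm (φ x)`, which equals `x` only propositionally, while the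
  -- tangent spaces depend on the point.
  have hcoeff : ∀ x', x' = x → ∀ i j, g.inner x' (coordVector φ x' i) (coordVector φ x' j)
      = g.inner x (coordVector φ x i) (coordVector φ x j) := by
    rintro _ rfl i j
    rfl
  rw [dotProduct_mulVec_eq_sum]
  simp only [metricCoeff, Matrix.of_apply]
  simp only [hcoeff _ (φ.left_inv hx)]
  conv_lhs => rw [hφ.eq_sum_coordVector hx a, hφ.eq_sum_coordVector hx b]
  simp only [map_sum, map_smul, _root_.sum_apply, _root_.smul_apply, smul_eq_mul,
    Finset.mul_sum]
  rw [Finset.sum_comm]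
  exact Finset.sum_congr rfl fun i _ => Finset.sum_congr rfl fun j _ => by ring

/-- The coordinate fields are images of constant fields under the tangent map of `φ.symm`, hence
smooth sections along it; the bundle metric applied to two of them is smooth. -/
theorem smoothMatrixOn_metricCoeff (g : Metric n M) (hφ : IsSmoothChart φ) :
    SmoothMatrixOn (metricCoeff g φ) φ.target := by
  have hvec : ∀ i : Fin n, ContMDiffOn (𝓡 n) (𝓡 n).tangent ∞
      (fun y => (⟨φ.symm y, coordVector φ (φ.symm y) i⟩ : TangentBundle (𝓡 n) M)) φ.target := by
    intro i
    have : IsManifold (𝓡 n) 1 M := IsManifold.of_le (n := ∞) (by simp)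
    have hT := (contMDiffOn_symm_of_mem_maximalAtlas hφ).contMDiffOn_tangentMapWithin (m := ∞)
      (by simp) φ.open_target.uniqueMDiffOn
    have hc : ContMDiffOn (𝓡 n) (𝓡 n).tangent ∞
        (fun y : Model n => (⟨y, (EuclideanSpace.single i (1 : ℝ) : Model n)⟩ :
          TangentBundle (𝓡 n) (Model n))) φ.target :=
      contMDiffOn_vectorSpace_iff_contDiffOn.2 contDiffOn_const
    refine (hT.comp hc fun y hy => hy).congr fun y hy => ?_
    simp only [Function.comp, tangentMapWithin]
    rw [mfderivWithin_of_isOpen φ.open_target hy,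
      hφ.coordVector_eq_mfderiv_symm (φ.map_target hy), φ.right_inv hy]
  intro i j
  have h := ContMDiffOn.clm_bundle_apply₂
    (E₃ := Bundle.Trivial M ℝ) (F₃ := ℝ)
    (g.contMDiff.comp_contMDiffOn (contMDiffOn_symm_of_mem_maximalAtlas hφ)) (hvec i) (hvec j)
  intro y hy
  have h' := h y hy
  rw [Bundle.contMDiffWithinAt_totalSpace] at h'
  exact h'.2.contDiffWithinAt

theorem metricCoeff_symm (g : Metric n M) (y : Model n) :
    (metricCoeff g φ y)ᵀ = metricCoeff g φ y := by
  ext i j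
  exact g.symm _ _ _

theorem metricCoeff_posDef (g : Metric n M) (hφ : IsSmoothChart φ) {y : Model n}
    (hy : y ∈ φ.target) : (metricCoeff g φ y).PosDef := by
  refine Matrix.PosDef.of_dotProduct_mulVec_pos (metricCoeff_symm g y) fun v hv => ?_
  have hx := φ.map_target hy
  obtain ⟨a, ha⟩ := (hφ.coords hx).surjective (WithLp.toLp 2 v)
  have hc : component φ (φ.symm y) a = v := by
    ext i
    rw [hφ.component_eq hx, ha]
  have hne : a ≠ 0 := by
    rintro rfl
    rw [map_zero] at ha
    exact hv (by simpa using ha.symm)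
  have := g.pos _ a hne
  rw [hφ.inner_eq g hx, hc, φ.right_inv hy] at this
  simpa using this

/-- The connection matrices of the Levi-Civita connection in a chart. -/
def christoffelMatrix (g : Metric n M) (φ : OpenPartialHomeomorph M (Model n)) (i : Fin n)
    (y : Model n) : Matrix (Fin n) (Fin n) ℝ :=
  Matrix.of fun k j => christoffel g φ k i j y

theorem isLeviCivitaOn_christoffelMatrix (g : Metric n M) (hφ : IsSmoothChart φ)
    {V : Set (Model n)} (hV : IsOpen V) (hVφ : V ⊆ φ.target) :
    IsLeviCivitaOn V (metricCoeff g φ) (christoffelMatrix g φ) := by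
  have hG : SmoothMatrixOn (metricCoeff g φ) V :=
    fun a b => (smoothMatrixOn_metricCoeff g hφ a b).mono hVφ
  have hdet : ∀ z ∈ V, (metricCoeff g φ z).det ≠ 0 :=
    fun z hz => (metricCoeff_posDef g hφ (hVφ hz)).det_pos.ne'
  have hsymm : ∀ a b z, metricCoeff g φ z a b = metricCoeff g φ z b a :=
    fun a b z => g.symm _ _ _
  refine ⟨hV, hG, ?_, fun y _ => metricCoeff_symm g y,
    fun y hy => metricCoeff_posDef g hφ (hVφ hy), ?_, ?_⟩
  · intro i k j
    simp only [christoffelMatrix, Matrix.of_apply, christoffel]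
    exact contDiffOn_const.mul (ContDiffOn.sum fun l _ => (hG.inv hdet k l).mul
      (((contDiffOn_partialDeriv hV (hG j l) i).add (contDiffOn_partialDeriv hV (hG i l) j)).sub
        (contDiffOn_partialDeriv hV (hG i j) l)))
  · intro y _ k i j
    simp only [christoffelMatrix, Matrix.of_apply, christoffel]
    congr 1
    refine Finset.sum_congr rfl fun l _ => ?_
    simp only [hsymm i j]
    ring
  · intro y hy i
    -- Christoffel symbols with the upper index lowered. Adding this expression to its transpose
    -- cancels all but the derivative of the metric, which is compatibility.
    have hlow : ∀ a j, (metricCoeff g φ y * christoffelMatrix g φ i y) a j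
        = (1 / 2 : ℝ) * (partialDeriv i (fun z => metricCoeff g φ z j a) y
          + partialDeriv j (fun z => metricCoeff g φ z i a) y
          - partialDeriv a (fun z => metricCoeff g φ z i j) y) := by
      intro a j
      obtain ⟨F, hF⟩ : ∃ F : Fin n → ℝ, F = fun l =>
          (1 / 2 : ℝ) * (partialDeriv i (fun z => metricCoeff g φ z j l) y
          + partialDeriv j (fun z => metricCoeff g φ z i l) y
          - partialDeriv l (fun z => metricCoeff g φ z i j) y) := ⟨_, rfl⟩
      have h1 : (fun k => christoffelMatrix g φ i y k j) = (metricCoeff g φ y)⁻¹ *ᵥ F := by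
        ext k
        simp only [christoffelMatrix, Matrix.of_apply, christoffel, mulVec, dotProduct, hF,
          Finset.mul_sum]
        exact Finset.sum_congr rfl fun l _ => by ring
      have h2 : (metricCoeff g φ y * christoffelMatrix g φ i y) a j
          = (metricCoeff g φ y *ᵥ fun k => christoffelMatrix g φ i y k j) a := rfl
      rw [h2, h1, mulVec_mulVec, Matrix.mul_nonsing_inv _ (hdet y hy).isUnit, one_mulVec, hF]
    have hT : (christoffelMatrix g φ i y)ᵀ * metricCoeff g φ y
        = (metricCoeff g φ y * christoffelMatrix g φ i y)ᵀ := by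
      rw [transpose_mul, metricCoeff_symm]
    ext a b
    rw [hT, Matrix.add_apply, Matrix.transpose_apply, hlow, hlow, matrixDeriv_apply]
    simp only [hsymm b a, hsymm i a, hsymm i b]
    ring

theorem riemann_eq_curvature (g : Metric n M) (φ : OpenPartialHomeomorph M (Model n))
    (l i j k : Fin n) (y : Model n) :
    riemann g φ l i j k y = curvature (christoffelMatrix g φ) i j y l k := by
  simp only [riemann, curvature, Matrix.add_apply, Matrix.sub_apply, Matrix.mul_apply,
    matrixDeriv_apply, christoffelMatrix, Matrix.of_apply, ← Finset.sum_sub_distrib]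
  congr 1
  exact Finset.sum_congr rfl fun m _ => by ring

theorem ricciForm_eq_ricci (g : Metric n M) (φ : OpenPartialHomeomorph M (Model n))
    (y : Model n) : ricciForm g φ y = ricci (christoffelMatrix g φ) y := by
  ext j k
  simp only [ricciForm, ricci, Matrix.of_apply, riemann_eq_curvature]

theorem jacobiOperator_eq_jacobiMatrix (g : Metric n M) (φ : OpenPartialHomeomorph M (Model n))
    (y : Model n) (v : Fin n → ℝ) : jacobiOperator g φ y v
      = jacobiMatrix (fun i j => curvature (christoffelMatrix g φ) i j y) v := by
  ext l i
  simp only [jacobiOperator, jacobiMatrix, Matrix.of_apply, riemann_eq_curvature]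

theorem covDerivEndo_eq (g : Metric n M) (φ : OpenPartialHomeomorph M (Model n)) (γ : ℝ → M)
    (u : ∀ t : ℝ, TangentSpace (𝓡 n) (γ t) →ₗ[ℝ] TangentSpace (𝓡 n) (γ t)) (t : ℝ) :
    covDerivEndo g φ γ u t = (Matrix.of fun i j => deriv (fun s => endoMatrix φ γ u s i j) t)
      + (connMatrix (christoffelMatrix g φ) (φ (γ t)) (coordVelocity φ γ t) * endoMatrix φ γ u t
        - endoMatrix φ γ u t
          * connMatrix (christoffelMatrix g φ) (φ (γ t)) (coordVelocity φ γ t)) := by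
  ext i j
  simp only [covDerivEndo, connMatrix, Matrix.of_apply, Matrix.add_apply, Matrix.sub_apply,
    Finset.sum_mul, Finset.mul_sum, Matrix.sum_apply, smul_mul_assoc, mul_smul_comm,
    Matrix.smul_apply, Matrix.mul_apply, smul_eq_mul, ← Finset.sum_sub_distrib, christoffelMatrix]
  congr 1
  exact Finset.sum_congr rfl fun k _ => Finset.sum_congr rfl fun l _ => by ring

end Chart

/-! ### Geodesics and Riccati solutions in a chart. -/

section Curve

variable {φ : OpenPartialHomeomorph M (Model n)} {γ : ℝ → M} {ε : ℝ}

theorem IsSmoothChart.contDiffOn_comp (hφ : IsSmoothChart φ)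
    (hγ : ContMDiffOn 𝓘(ℝ, ℝ) (𝓡 n) ∞ γ (Set.Ioo (-ε) ε)) (k : Fin n) :
    ContDiffOn ℝ ∞ (fun s => φ (γ s) k) (Set.Ioo (-ε) ε ∩ γ ⁻¹' φ.source) := by
  have h : ContMDiffOn 𝓘(ℝ, ℝ) (𝓡 n) ∞ (fun s => φ (γ s)) (Set.Ioo (-ε) ε ∩ γ ⁻¹' φ.source) :=
    (contMDiffOn_of_mem_maximalAtlas hφ).comp (hγ.mono Set.inter_subset_left)
      fun _ ht => ht.2
  exact (contDiffOn_euclidean.1 h.contDiffOn) k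

theorem IsSmoothChart.component_velocity (hφ : IsSmoothChart φ)
    (hγ : ContMDiffOn 𝓘(ℝ, ℝ) (𝓡 n) ∞ γ (Set.Ioo (-ε) ε)) {t : ℝ} (ht : t ∈ Set.Ioo (-ε) ε)
    (hts : γ t ∈ φ.source) :
    component φ (γ t) (velocity (n := n) γ t).2 = coordVelocity φ γ t := by
  ext k
  have hγt : MDifferentiableAt 𝓘(ℝ, ℝ) (𝓡 n) γ t :=
    (hγ.contMDiffAt (isOpen_Ioo.mem_nhds ht)).mdifferentiableAt (by simp)
  have hφt := hφ.mdifferentiable.mdifferentiableAt hts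
  have hcomp := mfderiv_comp t hφt hγt
  have hd : DifferentiableAt ℝ (φ ∘ γ) t :=
    mdifferentiableAt_iff_differentiableAt.1 (hφt.comp t hγt)
  rw [mfderiv_eq_fderiv] at hcomp
  have h1 : component φ (γ t) (velocity (n := n) γ t).2 k = fderiv ℝ (φ ∘ γ) t 1 k := by
    rw [hcomp]
    rfl
  have h2 : HasDerivAt (φ ∘ γ) (fderiv ℝ (φ ∘ γ) t 1) t := hd.hasFDerivAt.hasDerivAt
  have h3 : HasDerivAt (fun s => φ (γ s) k) (fderiv ℝ (φ ∘ γ) t 1 k) t :=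
    (EuclideanSpace.proj (𝕜 := ℝ) k).hasFDerivAt.comp_hasDerivAt t h2
  rw [h1, coordVelocity, h3.deriv]

variable [IsManifold (𝓡 n) ∞ M]

/-- The differential of the chart is onto, so every coordinate vector of unit length comes from a
unit tangent vector. The geodesic stays in the chart domain for small times, which is all the germ
conditions need. -/
theorem exists_isConstrainedRiccati {g : Metric n M} (hg : AdmitsConstrainedRiccatiSolutions g)
    (hφ : IsSmoothChart φ) {x : M} (hx : x ∈ φ.source) (v : Fin n → ℝ)
    (hv : v ⬝ᵥ metricCoeff g φ (φ x) *ᵥ v = 1) :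
    ∃ c w U, IsConstrainedRiccati (metricCoeff g φ) (christoffelMatrix g φ) (φ x) v c w U := by
  obtain ⟨a, ha⟩ := (hφ.coords hx).surjective (WithLp.toLp 2 v)
  have hc : component φ x a = v := by
    ext i
    rw [hφ.component_eq hx, ha]
  obtain ⟨ε, hε, γ, ⟨hγ, hgeo⟩, hvel, u, hric, hcon⟩ := hg ⟨x, a⟩ (by
    change g.inner x a a = 1
    rw [hφ.inner_eq g hx, hc, hv])
  have hN := hγ.continuousOn.isOpen_inter_preimage isOpen_Ioo φ.open_source
  have h0 : γ 0 = x := congrArg Bundle.TotalSpace.proj hvel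
  have h0N : (0 : ℝ) ∈ Set.Ioo (-ε) ε ∩ γ ⁻¹' φ.source := ⟨⟨by linarith, hε⟩, by
    change γ 0 ∈ φ.source
    rwa [h0]⟩
  have hev : ∀ᶠ t in 𝓝 (0 : ℝ), t ∈ Set.Ioo (-ε) ε ∩ γ ⁻¹' φ.source := hN.mem_nhds h0N
  have hw0 : coordVelocity φ γ 0 = v := by
    rw [← hφ.component_velocity hγ h0N.1 h0N.2, ← hc]
    exact congrArg (fun z : TangentBundle (𝓡 n) M => component φ z.1 z.2) hvel
  refine ⟨fun t => φ (γ t), coordVelocity φ γ, endoMatrix φ γ u, ?_⟩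
  constructor
  · rw [h0]
  · exact hw0
  · filter_upwards [hev] with t ht k
    exact (((hφ.contDiffOn_comp hγ k).contDiffAt (hN.mem_nhds ht)).differentiableAt
      (by simp)).hasDerivAt
  · intro k
    have hd : DifferentiableAt ℝ (fun s => coordVelocity φ γ s k) 0 :=
      (((hφ.contDiffOn_comp hγ k).deriv_of_isOpen hN (m := ∞) (by simp)).contDiffAt
        (hN.mem_nhds h0N)).differentiableAt (by simp)
    refine hd.hasDerivAt.congr_deriv ?_
    have hk := hgeo φ hφ 0 h0N.1 h0N.2 k
    rw [hw0, h0] at hk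
    have hsum : (connMatrix (christoffelMatrix g φ) (φ x) v *ᵥ v) k
        = ∑ i, ∑ j, christoffel g φ k i j (φ x) * v i * v j := by
      simp only [connMatrix, mulVec, dotProduct, Matrix.sum_apply, Matrix.smul_apply, smul_eq_mul,
        christoffelMatrix, Matrix.of_apply, Finset.sum_mul]
      rw [Finset.sum_comm]
      exact Finset.sum_congr rfl fun i _ => Finset.sum_congr rfl fun j _ => by ring
    rw [hsum]
    linarith
  · filter_upwards [hev] with t ht
    exact (hric φ hφ t ht.1 ht.2).1
  · filter_upwards [hev] with t ht
    have := (hric φ hφ t ht.1 ht.2).2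
    rwa [covDerivEndo_eq, jacobiOperator_eq_jacobiMatrix] at this
  · filter_upwards [hev] with t ht
    have hs := (hcon t ht.1).1
    ext i j
    have hij := hs (coordVector φ (γ t) i) (coordVector φ (γ t) j)
    rw [hφ.inner_eq g ht.2, hφ.inner_eq g ht.2, ← hφ.endoMatrix_mulVec u ht.2,
      ← hφ.endoMatrix_mulVec u ht.2, hφ.component_coordVector ht.2,
      hφ.component_coordVector ht.2] at hij
    simp only [mulVec_single_one, single_dotProduct, one_mul] at hij
    rw [Matrix.mul_apply, Matrix.mul_apply]
    exact hij
  · filter_upwards [hev] with t ht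
    rw [hφ.trace_endoMatrix u ht.2]
    exact (hcon t ht.1).2.1
  · filter_upwards [hev] with t ht
    rw [← hφ.component_velocity hγ ht.1 ht.2]
    refine (hφ.endoMatrix_mulVec u ht.2 _).trans ?_
    ext i
    rw [hφ.component_eq ht.2, (hcon t ht.1).2.2, map_zero]
    rfl

end Curve

end RiccatiGeometry

end

theorem proposition2p7 {M : Type*} [TopologicalSpace M]
    [ChartedSpace (EuclideanSpace ℝ (Fin 3)) M] [IsManifold (𝓡 3) ∞ M]
    (g : RiccatiGeometry.Metric 3 M)
    (hg : RiccatiGeometry.AdmitsConstrainedRiccatiSolutions g) :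
    ∀ U : Set M, IsOpen U → (∀ x ∈ U, RiccatiGeometry.RicciHasRank g x 1) → U = ∅ := by
  intro U hU hrank
  rw [Set.eq_empty_iff_forall_notMem]
  intro x hxU
  obtain ⟨φ, hφ, hx⟩ : ∃ φ : OpenPartialHomeomorph M (RiccatiGeometry.Model 3),
      RiccatiGeometry.IsSmoothChart φ ∧ x ∈ φ.source :=
    ⟨chartAt _ x, IsManifold.chart_mem_maximalAtlas x, mem_chart_source _ x⟩
  -- The open set used is the part of the chart's target that `φ.symm` maps into `U`, so the rank
  -- hypothesis holds near `φ x` and may be differentiated.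
  refine RiccatiGeometry.false_of_ricci_rank_one (y := φ x)
    (RiccatiGeometry.isLeviCivitaOn_christoffelMatrix g hφ
      (φ.isOpen_inter_preimage_symm hU) Set.inter_subset_left)
    ⟨φ.map_source hx, by simpa [φ.left_inv hx] using hxU⟩ ?_
    fun v hv => RiccatiGeometry.exists_isConstrainedRiccati hg hφ hx v hv
  intro z hz
  have := hrank _ hz.2 φ hφ (φ.map_target hz.1)
  rwa [φ.right_inv hz.1, RiccatiGeometry.ricciOperator,
    RiccatiGeometry.ricciForm_eq_ricci] at this
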